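/- Let $n,\ell,i$ be integers with $1\le \ell\le n/2$ and $i+\ell\le n$, and write $\mathbb R^n=\mathbb R^{n-\ell}\oplus\mathbb R^{\ell}$, where $\mathbb R^{n-\ell}$ and $\mathbb R^{\ell}$ are spanned by the first $n-\ell$ and the last $\ell$ coordinate vectors. A star body in $\mathbb R^n$ is a compact set $K$ with non-empty interior such that $tK\subset K$ for all $t\in[0,1]$ and whose radial function $\rho_K(\theta)=\sup\{t\ge 0: t\theta\in K\}$ is continuous on the unit sphere $S^{n-1}$; it is origin-symmetric if $K=-K$. Let $K_\ell\cong O(n-\ell)\times O(\ell)$ be the group of orthogonal transformations of $\mathbb R^n$ that preserve both $\mathbb R^{n-\ell}$ and $\mathbb R^\ell$. The canonical angles $\omega_1,\dots,\omega_m\in[0,\pi/2]$, $m=\min(i,\ell)$, between an $i$-dimensional linear subspace $\xi$ and $\mathbb R^\ell$ are defined by letting $\cos^2\omega_1,\dots,\cos^2\omega_m$ be the eigenvalues, with multiplicity, of the compression to $\xi$ of the orthogonal projection onto $\mathbb R^\ell$ if $i\le\ell$, and of the compression to $\mathbb R^\ell$ of the orthogonal projection onto $\xi$ if $i>\ell$.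 Let $G_{n,i}^{\ell}$ be the set of all $i$-dimensional linear subspaces $\xi$ of $\mathbb R^n$ with $\omega_1=\dots=\omega_m$. Let $A$ be a star body in $\mathbb R^n$ that is $K_\ell$-symmetric, i.e. $\gamma A=A$ for all $\gamma\in K_\ell$. (a) If $1\le i\le \ell$, then for every origin-symmetric star body $B$ in $\mathbb R^n$ the implication $$\mathrm{vol}_i(A\cap\xi)\le \mathrm{vol}_i(B\cap\xi)\ \text{ for all } \xi\in G_{n,i}^{\ell}\quad\Longrightarrow\quad \mathrm{vol}_n(A)\le \mathrm{vol}_n(B)$$ holds. (b) If $i=\ell+1$ or $i=\ell+2$, and $A$ is convex, then the same implication holds for every origin-symmetric star body $B$ in $\mathbb R^n$. -/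

import Mathlib

open MeasureTheory

namespace BusemannPetty

/-- Euclidean space of dimension `n`. -/
abbrev E (n : ℕ) : Type := EuclideanSpace ℝ (Fin n)

/-! ### Star bodies -/

/-- The radial function `ρ_K(θ) = sup {t ≥ 0 : t θ ∈ K}`. -/
noncomputable def radialFunction {n : ℕ} (K : Set (E n)) (θ : E n) : ℝ :=
  sSup {t : ℝ | 0 ≤ t ∧ t • θ ∈ K}

/-- A star body: a compact set with non-empty interior, star-shaped about the origin, whose
radial function is continuous on the unit sphere. Origin-symmetry is a separate predicate,
and the origin need not be an interior point. -/
structure IsStarBody {n : ℕ} (K : Set (E n)) : Prop where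
  isCompact : IsCompact K
  interior_nonempty : (interior K).Nonempty
  smul_mem : ∀ t ∈ Set.Icc (0 : ℝ) 1, ∀ x ∈ K, t • x ∈ K
  continuousOn_radialFunction : ContinuousOn (radialFunction K) (Metric.sphere (0 : E n) 1)

/-- `K = -K`. -/
def IsOriginSymmetric {n : ℕ} (K : Set (E n)) : Prop :=
  ∀ x, x ∈ K ↔ -x ∈ K

/-! ### The symmetry group `K_ℓ ≅ O(n-ℓ) × O(ℓ)` -/

/-- The coordinate subspace `ℝ^ℓ` of `ℝ^n`, spanned by the last `ℓ` coordinate vectors. -/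
noncomputable def lastCoords (n ℓ : ℕ) : Submodule ℝ (E n) :=
  Submodule.span ℝ {v | ∃ j : Fin n, n ≤ (j : ℕ) + ℓ ∧ v = EuclideanSpace.single j (1 : ℝ)}

/-- The coordinate subspace `ℝ^(n-ℓ)` of `ℝ^n`, spanned by the first `n - ℓ` coordinate vectors. -/
noncomputable def firstCoords (n ℓ : ℕ) : Submodule ℝ (E n) :=
  Submodule.span ℝ {v | ∃ j : Fin n, (j : ℕ) + ℓ < n ∧ v = EuclideanSpace.single j (1 : ℝ)}

/-- The group `K_ℓ` of the orthogonal transformations of `ℝ^n` that preserve the decomposition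
`ℝ^n = ℝ^(n-ℓ) ⊕ ℝ^ℓ`, i.e. those with a block diagonal matrix. -/
def blockOrthogonal (n ℓ : ℕ) : Set (E n ≃ₗᵢ[ℝ] E n) :=
  {γ | (∀ x ∈ firstCoords n ℓ, γ x ∈ firstCoords n ℓ) ∧
    ∀ x ∈ lastCoords n ℓ, γ x ∈ lastCoords n ℓ}

/-- `γ A = A` for all `γ ∈ K_ℓ`. -/
def IsBlockSymmetric {n : ℕ} (ℓ : ℕ) (A : Set (E n)) : Prop :=
  ∀ γ ∈ blockOrthogonal n ℓ, γ '' A = A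

/-! ### Canonical angles -/

/-- The compression of the orthogonal projection `P_V` to `U`. In an orthonormal basis `τ` of `U`
its matrix is `τ' P_V τ`. -/
noncomputable def compression {n : ℕ} (U V : Submodule ℝ (E n)) : U →ₗ[ℝ] U :=
  (U.orthogonalProjectionOnto ∘L V.starProjection ∘L U.subtypeL).toLinearMap

theorem inner_compression {n : ℕ} (U V : Submodule ℝ (E n)) (x y : U) :
    inner ℝ (compression U V x) y = inner ℝ (V.starProjection (x : E n)) (y : E n) :=
  U.inner_orthogonalProjectionOnto_eq_of_mem_right y (V.starProjection (x : E n))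

theorem compression_isSymmetric {n : ℕ} (U V : Submodule ℝ (E n)) :
    (compression U V).IsSymmetric := by
  intro x y
  rw [inner_compression, ← real_inner_comm x (compression U V y), inner_compression,
    real_inner_comm, Submodule.inner_starProjection_left_eq_right]

/-- The canonical (principal) angles `ω_j` between `U` and `V`, where `dim U ≤ dim V`: the
numbers `cos² ω_j` are the eigenvalues, with multiplicity, of the compression of `P_V` to `U`. -/
noncomputable def canonicalAngles {n : ℕ} (U V : Submodule ℝ (E n)) :
    Fin (Module.finrank ℝ U) → ℝ :=
  fun j => Real.arccos (Real.sqrt ((compression_isSymmetric U V).eigenvalues rfl j))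

open Classical in
/-- All `min (dim U) (dim V)` canonical angles between `U` and `V` are equal. They are read off
on the subspace of the smaller dimension. -/
def HasEqualCanonicalAngles {n : ℕ} (U V : Submodule ℝ (E n)) : Prop :=
  if Module.finrank ℝ U ≤ Module.finrank ℝ V then
    ∀ j k, canonicalAngles U V j = canonicalAngles U V k
  else
    ∀ j k, canonicalAngles V U j = canonicalAngles V U k

/-- The set of the `i`-dimensional subspaces of `ℝ^n` all of whose canonical angles with `ℝ^ℓ`
are equal. -/
def equalAngleGrassmannian (n i ℓ : ℕ) : Set (Submodule ℝ (E n)) :=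
  {ξ | Module.finrank ℝ ξ = i ∧ HasEqualCanonicalAngles ξ (lastCoords n ℓ)}

/-! ### Volumes of sections -/

/-- The volume of `K ∩ ξ` in the dimension of `ξ`: the Lebesgue measure that the Euclidean
space `ξ` carries, evaluated on `K ∩ ξ` as a subset of `ξ`. -/
noncomputable def sectionVolume {n : ℕ} (K : Set (E n)) (ξ : Submodule ℝ (E n)) : ENNReal :=
  (measureSpaceOfInnerProductSpace (E := ξ)).volume {x : ξ | (x : E n) ∈ K}

/-- The sections of `A` by the `i`-dimensional subspaces with equal canonical angles with `ℝ^ℓ`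
have at most the volume of the corresponding sections of `B`. -/
def SectionsLE {n : ℕ} (i ℓ : ℕ) (A B : Set (E n)) : Prop :=
  ∀ ξ ∈ equalAngleGrassmannian n i ℓ, sectionVolume A ξ ≤ sectionVolume B ξ

end BusemannPetty

namespace BusemannPetty

open Set ENNReal

/-! Let `ρ` be the radial function of `A`, `m = n - ℓ` and `N = n - i`. The weight `W = ρ ^ N` is at
least 1 on `A \ {0}` and at most 1 off `A`, so `∫_A W ≤ ∫_B W` forces `vol A ≤ vol B`
(`IsStarBody.volume_le`). It remains to write `∫_K W`, up to a positive factor independent of `K`,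
as a positive superposition of section volumes of `K` over subspaces with equal canonical angles.

Since `W` is invariant under `O(m) × O(ℓ)`, the indicator of `K` may be replaced by its rotation
average, a function `Φ_K(q, p)` of `q = ‖z‖` and `p = ‖y‖` for `x = (y, z)`. Then `∫_K W` becomes a
planar integral of `Φ_K` against `p^(m-1) q^(ℓ-1) h(q/p) p^(-N)`, where `h(u) = ρ(e, u e')^N` for
unit vectors `e`, `e'` (`volume_le_of_profile_le`). The class of subspaces is stable under the
rotations, so averaged section volumes are planar integrals of `Φ_K` too (`lintegral_profile_le`).

For `i ≤ ℓ` the subspace `{(s S x, c T x)}` yields the integral of `r^(i-1) Φ_K` along the ray of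
direction `(c, s)`. Slicing the quadrant by rays gives the superposition for every nonnegative `h`
(`lintegral_cone_le`), so convexity plays no role.

For `i = ℓ + k` the subspace `{(S(s z, w), c z)}` yields an integral over the wedge `p > τ q`, `τ =
s/c`, with density `q^(ℓ-1) p (p² - τ² q²)^((k-2)/2)`. For `k = 2` this is the wedge indicator times
`q^(ℓ-1) p^(k-1)`; for `k = 1` an Abel transform in the slope produces it (`wedge_section_le`).
Convexity and the symmetry `z ↦ -z` make `h` antitone, hence a superposition of wedge indicators
(`lintegral_antitone_le`). -/

/-! ### Weighted comparison and changes of variables -/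

theorem measure_le_of_setLIntegral_le {X : Type*} [MeasurableSpace X] {μ : Measure X}
    {A B : Set X} (hA : MeasurableSet A) (hB : MeasurableSet B) {W : X → ℝ≥0∞}
    (hW_in : ∀ x ∈ A, 1 ≤ W x) (hW_out : ∀ x ∉ A, W x ≤ 1) (hfin : ∫⁻ x in A, W x ∂μ ≠ ∞)
    (h : ∫⁻ x in A, W x ∂μ ≤ ∫⁻ x in B, W x ∂μ) : μ A ≤ μ B := by
  have hle : ∫⁻ x in A \ B, W x ∂μ ≤ ∫⁻ x in B \ A, W x ∂μ := by
    rw [← lintegral_inter_add_sdiff W A hB, ← lintegral_inter_add_sdiff W B hA, inter_comm B A] at h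
    -- The common part `A ∩ B` cancels, which is where finiteness of the weighted integral over `A`
    -- enters.
    refine (ENNReal.add_le_add_iff_left ?_).1 h
    exact ((lintegral_mono_set inter_subset_left).trans_lt hfin.lt_top).ne
  have h1 : μ (A \ B) ≤ ∫⁻ x in A \ B, W x ∂μ := by
    rw [← setLIntegral_one]
    exact setLIntegral_mono' (hA.diff hB) fun x hx => hW_in x hx.1
  have h2 : ∫⁻ x in B \ A, W x ∂μ ≤ μ (B \ A) := by
    rw [← setLIntegral_one]
    exact setLIntegral_mono' (hB.diff hA) fun x hx => hW_out x hx.2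
  rw [← measure_inter_add_sdiff A hB, ← measure_inter_add_sdiff B hA, inter_comm B A]
  refine add_le_add le_rfl ?_
  exact h1.trans (hle.trans h2)

theorem lintegral_fun_norm {V : Type*} [NormedAddCommGroup V] [NormedSpace ℝ V]
    [FiniteDimensional ℝ V] [MeasurableSpace V] [BorelSpace V] [Nontrivial V]
    (μ : Measure V) [μ.IsAddHaarMeasure] {f : ℝ → ℝ≥0∞} (hf : Measurable f) :
    ∫⁻ x, f ‖x‖ ∂μ = μ.toSphere univ *
      ∫⁻ r in Ioi (0 : ℝ), ENNReal.ofReal (r ^ (Module.finrank ℝ V - 1)) * f r := by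
  have h1 : ∫⁻ x, f ‖x‖ ∂μ = ∫⁻ x : ({(0)}ᶜ : Set V), f ‖x.1‖ ∂(μ.comap (↑)) := by
    rw [lintegral_subtype_comap (measurableSet_singleton _).compl fun x ↦ f (‖x‖),
      restrict_compl_singleton]
  have h2 := (μ.measurePreserving_homeomorphUnitSphereProd).lintegral_comp_emb
    (Homeomorph.measurableEmbedding _) (fun x => f (x.2 : ℝ))
  simp only [homeomorphUnitSphereProd_apply_snd_coe] at h2
  rw [h1, h2, lintegral_prod _ (by fun_prop)]
  simp only [lintegral_const]
  rw [mul_comm, Measure.volumeIoiPow, lintegral_withDensity_eq_lintegral_mul _ (by fun_prop)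
    (by fun_prop)]
  congr 1
  exact lintegral_subtype_comap measurableSet_Ioi
    (fun a : ℝ => ENNReal.ofReal (a ^ (Module.finrank ℝ V - 1)) * f a)

theorem lintegral_Ioi_comp_mul_left (f : ℝ → ℝ≥0∞) {c : ℝ} (hc : 0 < c) :
    ∫⁻ q in Ioi (0 : ℝ), f q = ∫⁻ r in Ioi (0 : ℝ), ENNReal.ofReal c * f (c * r) := by
  have h := lintegral_image_eq_lintegral_abs_deriv_mul (s := Ioi (0 : ℝ)) (f := fun r => c * r)
    (f' := fun _ => c) measurableSet_Ioi
    (fun x _ => by simpa using ((hasDerivAt_id x).const_mul c).hasDerivWithinAt)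
    (fun x _ y _ h => mul_left_cancel₀ hc.ne' h) f
  rw [abs_of_pos hc] at h
  rw [← h]
  congr 2
  ext x
  simp only [mem_Ioi, mem_image]
  exact ⟨fun hx => ⟨x / c, by positivity, by field_simp⟩, fun ⟨y, hy, h⟩ => h ▸ by positivity⟩

theorem lintegral_Ioi_comp_sqrt (f : ℝ → ℝ≥0∞) {a : ℝ} (ha : 0 ≤ a) :
    ∫⁻ p in Ioi a, f p =
      ∫⁻ t in Ioi (0 : ℝ), ENNReal.ofReal (t / √(a ^ 2 + t ^ 2)) * f √(a ^ 2 + t ^ 2) := by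
  have h := lintegral_image_eq_lintegral_abs_deriv_mul (s := Ioi (0 : ℝ))
    (f := fun t => √(a ^ 2 + t ^ 2)) (f' := fun t => t / √(a ^ 2 + t ^ 2)) measurableSet_Ioi
    (fun t (ht : 0 < t) => by
      have h1 : HasDerivAt (fun t : ℝ => a ^ 2 + t ^ 2) (2 * t) t := by
        simpa using ((hasDerivAt_id t).pow 2).const_add (a ^ 2)
      convert! (h1.sqrt (by positivity)).hasDerivWithinAt using 1
      ring)
    (fun x (hx : 0 < x) y (hy : 0 < y) h => by
      simp only at h
      rw [Real.sqrt_inj (by positivity) (by positivity)] at h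
      exact (pow_left_inj₀ hx.le hy.le two_ne_zero).1 (add_left_cancel h)) f
  have himg : (fun t => √(a ^ 2 + t ^ 2)) '' Ioi (0 : ℝ) = Ioi a := by
    ext x
    simp only [mem_Ioi, mem_image]
    constructor
    · rintro ⟨t, ht, rfl⟩
      exact Real.lt_sqrt_of_sq_lt (by have := pow_pos ht 2; linarith)
    · intro hx
      have : 0 < x ^ 2 - a ^ 2 := by nlinarith
      refine ⟨√(x ^ 2 - a ^ 2), Real.sqrt_pos.2 this, ?_⟩
      rw [Real.sq_sqrt this.le, add_sub_cancel, Real.sqrt_sq (ha.trans hx.le)]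
  rw [← himg, h]
  refine setLIntegral_congr_fun measurableSet_Ioi fun t (ht : 0 < t) => ?_
  rw [abs_of_nonneg (by positivity)]

/-! ### Slicing the quadrant by rays -/

/-- Substituting `q = u p` leaves the power `p^(m+l+1-N) = p^i` on the ray `q/p = u`; rescaled to a
unit direction, each ray integral is an instance of `hsec`, and the nonnegative factor `u^l h(u)`
preserves the inequality. The exponents `m`, `l`, `i` stand for dimensions minus one. -/
theorem lintegral_cone_le {Φ₁ Φ₂ : ℝ × ℝ → ℝ≥0∞} (hΦ₁ : Measurable Φ₁) (hΦ₂ : Measurable Φ₂)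
    {h : ℝ → ℝ≥0∞} (hh : Measurable h) {i m l N : ℕ} (hN : m + l + 1 = N + i)
    (hsec : ∀ c s : ℝ, 0 < c → 0 < s → c ^ 2 + s ^ 2 = 1 →
      ∫⁻ r in Ioi (0 : ℝ), ENNReal.ofReal (r ^ i) * Φ₁ (c * r, s * r) ≤
        ∫⁻ r in Ioi (0 : ℝ), ENNReal.ofReal (r ^ i) * Φ₂ (c * r, s * r)) :
    ∫⁻ p in Ioi (0 : ℝ), ∫⁻ q in Ioi (0 : ℝ), ENNReal.ofReal (p ^ m) * (ENNReal.ofReal (q ^ l) *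
        (h (q / p) * ENNReal.ofReal ((p ^ N)⁻¹) * Φ₁ (q, p))) ≤
      ∫⁻ p in Ioi (0 : ℝ), ∫⁻ q in Ioi (0 : ℝ), ENNReal.ofReal (p ^ m) * (ENNReal.ofReal (q ^ l) *
        (h (q / p) * ENNReal.ofReal ((p ^ N)⁻¹) * Φ₂ (q, p))) := by
  have key : ∀ Φ : ℝ × ℝ → ℝ≥0∞, Measurable Φ →
      ∫⁻ p in Ioi (0 : ℝ), ∫⁻ q in Ioi (0 : ℝ), ENNReal.ofReal (p ^ m) * (ENNReal.ofReal (q ^ l) *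
        (h (q / p) * ENNReal.ofReal ((p ^ N)⁻¹) * Φ (q, p))) =
      ∫⁻ u in Ioi (0 : ℝ), (ENNReal.ofReal (u ^ l) * h u) *
        ∫⁻ p in Ioi (0 : ℝ), ENNReal.ofReal (p ^ i) * Φ (u * p, p) := by
    intro Φ hΦ
    have h1 : ∀ u, (ENNReal.ofReal (u ^ l) * h u) *
        ∫⁻ p in Ioi (0 : ℝ), ENNReal.ofReal (p ^ i) * Φ (u * p, p) =
        ∫⁻ p in Ioi (0 : ℝ), (ENNReal.ofReal (u ^ l) * h u) *
          (ENNReal.ofReal (p ^ i) * Φ (u * p, p)) := fun u =>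
      (lintegral_const_mul _ (by fun_prop)).symm
    simp only [h1]
    conv_rhs => rw [lintegral_lintegral_swap (by fun_prop)]
    refine setLIntegral_congr_fun measurableSet_Ioi fun p (hp : 0 < p) => ?_
    rw [lintegral_Ioi_comp_mul_left _ hp]
    refine setLIntegral_congr_fun measurableSet_Ioi fun u (hu : 0 < u) => ?_
    have h2 : p * (p ^ m * (p * u) ^ l * (p ^ N)⁻¹) = u ^ l * p ^ i := by
      have : p ^ (m + l + 1) = p ^ (N + i) := by rw [hN]
      field_simp
      rw [mul_pow]
      linear_combination u ^ l * this
    rw [mul_div_cancel_left₀ _ hp.ne', mul_comm p u, mul_comm u p]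
    calc _ = (ENNReal.ofReal p * (ENNReal.ofReal (p ^ m) * ENNReal.ofReal ((p * u) ^ l) *
          ENNReal.ofReal ((p ^ N)⁻¹))) * (h u * Φ (p * u, p)) := by ring
      _ = (ENNReal.ofReal (u ^ l) * ENNReal.ofReal (p ^ i)) * (h u * Φ (p * u, p)) := by
        rw [← ENNReal.ofReal_mul (by positivity), ← ENNReal.ofReal_mul (by positivity),
          ← ENNReal.ofReal_mul (by positivity), ← ENNReal.ofReal_mul (by positivity), h2]
      _ = _ := by ring
  rw [key _ hΦ₁, key _ hΦ₂]
  refine setLIntegral_mono' measurableSet_Ioi fun u (hu : 0 < u) => ?_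
  refine mul_le_mul' le_rfl ?_
  have hpos : 0 < √(1 + u ^ 2) := by positivity
  have hs : 0 < (√(1 + u ^ 2))⁻¹ := by positivity
  have hscale : ∀ Φ : ℝ × ℝ → ℝ≥0∞, Measurable Φ →
      ∫⁻ p in Ioi (0 : ℝ), ENNReal.ofReal (p ^ i) * Φ (u * p, p) =
        (ENNReal.ofReal (√(1 + u ^ 2))⁻¹ * ENNReal.ofReal ((√(1 + u ^ 2))⁻¹ ^ i)) *
        ∫⁻ r in Ioi (0 : ℝ), ENNReal.ofReal (r ^ i) *
          Φ ((u * (√(1 + u ^ 2))⁻¹) * r, (√(1 + u ^ 2))⁻¹ * r) := by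
    intro Φ hΦ
    rw [lintegral_Ioi_comp_mul_left _ hs, ← lintegral_const_mul _ (by fun_prop)]
    refine setLIntegral_congr_fun measurableSet_Ioi fun r (hr : 0 < r) => ?_
    rw [mul_pow, ENNReal.ofReal_mul (by positivity), ← mul_assoc u]
    ring
  rw [hscale _ hΦ₁, hscale _ hΦ₂]
  refine mul_le_mul' le_rfl ?_
  refine hsec _ _ (by positivity) hs ?_
  rw [mul_pow, inv_pow, Real.sq_sqrt (by positivity)]
  field_simp
  ring

/-! ### Abel inversion in the slope -/

/-- An antiderivative is `-arcsin(x(s)) / 2`, where `x` is affine in `1/s²` and takes the values 1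
at `τ` and -1 at `σ`. It is continuous up to the singular endpoints, and nonnegativity of its
derivative supplies integrability. -/
theorem abel_integral {τ σ : ℝ} (hτ : 0 < τ) (hτσ : τ < σ) :
    ∫⁻ s in Ioo τ σ, ENNReal.ofReal (τ / (s * √(s ^ 2 - τ ^ 2)) * (σ / √(σ ^ 2 - s ^ 2))) =
      ENNReal.ofReal (Real.pi / 2) := by
  have hσ : 0 < σ := hτ.trans hτσ
  have hd : 0 < σ ^ 2 - τ ^ 2 := by nlinarith
  set x : ℝ → ℝ := fun s => (2 * τ ^ 2 * σ ^ 2 / s ^ 2 - (σ ^ 2 + τ ^ 2)) / (σ ^ 2 - τ ^ 2) with hx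
  set G : ℝ → ℝ := fun s => -(1 / 2) * Real.arcsin (x s) with hG
  have hcont : ContinuousOn G (Icc τ σ) := by
    refine continuousOn_const.mul (Real.continuous_arcsin.comp_continuousOn ?_)
    refine ContinuousOn.div_const (ContinuousOn.sub (continuousOn_const.div (by fun_prop) ?_)
      continuousOn_const) _
    intro s hs
    have : 0 < s := hτ.trans_le hs.1
    positivity
  have hderiv : ∀ s ∈ Ioo τ σ, HasDerivAt G
      (τ / (s * √(s ^ 2 - τ ^ 2)) * (σ / √(σ ^ 2 - s ^ 2))) s := by
    intro s hs
    have hs0 : 0 < s := hτ.trans hs.1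
    have h1 : 0 < s ^ 2 - τ ^ 2 := by nlinarith [hs.1]
    have h2 : 0 < σ ^ 2 - s ^ 2 := by nlinarith [hs.2]
    have hx' : HasDerivAt x (-(4 * τ ^ 2 * σ ^ 2 / (s ^ 3 * (σ ^ 2 - τ ^ 2)))) s := by
      have h3 : HasDerivAt (fun s : ℝ => 2 * τ ^ 2 * σ ^ 2 / s ^ 2)
          (-(4 * τ ^ 2 * σ ^ 2 / s ^ 3)) s := by
        convert! (hasDerivAt_const s (2 * τ ^ 2 * σ ^ 2)).div ((hasDerivAt_id s).pow 2)
          (by simp only [Pi.pow_apply, id]; positivity) using 1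
        simp
        field_simp
        ring
      convert! (h3.sub_const (σ ^ 2 + τ ^ 2)).div_const (σ ^ 2 - τ ^ 2) using 1
      field_simp
    have hsq : 1 - x s ^ 2 = (2 * τ * σ / (s ^ 2 * (σ ^ 2 - τ ^ 2))) ^ 2 *
        ((s ^ 2 - τ ^ 2) * (σ ^ 2 - s ^ 2)) := by
      simp only [hx]
      field_simp
      ring
    have hpos : 0 < 1 - x s ^ 2 := by rw [hsq]; positivity
    have hroot : √(1 - x s ^ 2) = 2 * τ * σ / (s ^ 2 * (σ ^ 2 - τ ^ 2)) *
        (√(s ^ 2 - τ ^ 2) * √(σ ^ 2 - s ^ 2)) := by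
      rw [hsq, Real.sqrt_mul (by positivity), Real.sqrt_sq (by positivity), Real.sqrt_mul h1.le]
    have hne1 : x s ≠ -1 := by intro h; rw [h] at hpos; norm_num at hpos
    have hne2 : x s ≠ 1 := by intro h; rw [h] at hpos; norm_num at hpos
    convert! ((Real.hasDerivAt_arcsin hne1 hne2).comp s hx').const_mul (-(1 / 2)) using 1
    rw [hroot]
    have := Real.sqrt_pos.2 h1
    have := Real.sqrt_pos.2 h2
    field_simp
    ring
  have hnn : ∀ s ∈ Ioo τ σ, 0 ≤ τ / (s * √(s ^ 2 - τ ^ 2)) * (σ / √(σ ^ 2 - s ^ 2)) := by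
    intro s hs
    have hs0 : 0 < s := hτ.trans hs.1
    positivity
  have hint := intervalIntegral.integrableOn_deriv_of_nonneg hcont hderiv hnn
  have hval := intervalIntegral.integral_eq_sub_of_hasDerivAt_of_le hτσ.le hcont hderiv
    ((intervalIntegrable_iff_integrableOn_Ioc_of_le hτσ.le).2 hint)
  rw [intervalIntegral.integral_of_le hτσ.le, integral_Ioc_eq_integral_Ioo] at hval
  have hxτ : x τ = 1 := by simp only [hx]; field_simp; ring
  have hxσ : x σ = -1 := by simp only [hx]; field_simp; ring
  rw [← ofReal_integral_eq_lintegral_ofReal (hint.mono_set Ioo_subset_Ioc_self)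
    ((ae_restrict_iff' measurableSet_Ioo).2 (.of_forall hnn)), hval]
  simp only [hG, hxτ, hxσ, Real.arcsin_one, Real.arcsin_neg_one]
  congr 1
  ring

theorem abel_kernel {τ p q : ℝ} (hτ : 0 < τ) (hp : 0 < p) (hq : 0 < q) :
    ∫⁻ s in Ioi (0 : ℝ), ENNReal.ofReal (τ / (s * √(s ^ 2 - τ ^ 2))) *
        ENNReal.ofReal (p / √(p ^ 2 - (s * q) ^ 2)) =
      ENNReal.ofReal (Real.pi / 2) * if τ * q < p then 1 else 0 := by
  -- Since `√` of a negative number and division by zero are both 0, the integrand vanishes by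
  -- itself outside `τ < s < p/q`.
  have hsupp : ∀ s ∈ Ioi (0 : ℝ), ENNReal.ofReal (τ / (s * √(s ^ 2 - τ ^ 2))) *
        ENNReal.ofReal (p / √(p ^ 2 - (s * q) ^ 2)) =
      (Ioo τ (p / q)).indicator (fun s => ENNReal.ofReal
        (τ / (s * √(s ^ 2 - τ ^ 2)) * (p / q / √((p / q) ^ 2 - s ^ 2)))) s := by
    intro s hs
    have hs : 0 < s := hs
    by_cases h1 : s ≤ τ
    · rw [Real.sqrt_eq_zero_of_nonpos (by nlinarith : s ^ 2 - τ ^ 2 ≤ 0), indicator_of_notMem]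
      · simp
      · exact fun h => h.1.not_ge h1
    by_cases h2 : p / q ≤ s
    · have h3 : p ≤ s * q := (div_le_iff₀ hq).1 h2
      rw [Real.sqrt_eq_zero_of_nonpos (by nlinarith : p ^ 2 - (s * q) ^ 2 ≤ 0), indicator_of_notMem]
      · simp
      · exact fun h => h.2.not_ge h2
    rw [indicator_of_mem (show s ∈ Ioo τ (p / q) from ⟨not_le.1 h1, not_le.1 h2⟩), ← ENNReal.ofReal_mul (by positivity)]
    congr 2
    have h4 : p ^ 2 - (s * q) ^ 2 = q ^ 2 * ((p / q) ^ 2 - s ^ 2) := by field_simp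
    rw [h4, Real.sqrt_mul (by positivity), Real.sqrt_sq hq.le]
    field_simp
  rw [setLIntegral_congr_fun measurableSet_Ioi hsupp, lintegral_indicator measurableSet_Ioo,
    Measure.restrict_restrict measurableSet_Ioo,
    inter_eq_self_of_subset_left (show Ioo τ (p / q) ⊆ Ioi 0 from fun s hs => hτ.trans hs.1)]
  split_ifs with h
  · rw [abel_integral hτ ((lt_div_iff₀ hq).2 h), mul_one]
  · rw [Ioo_eq_empty (fun h' => h ((lt_div_iff₀ hq).1 h'))]
    simp

/-! ### From slopes to wedges, and from wedges to monotone weights -/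

/-- The density that the sections by subspaces of slope `a` induce on the second radius. -/
noncomputable def slopeKernel (j : ℕ) (a p : ℝ) : ℝ :=
  -- Dividing by the root, instead of using the exponent `j - 1`, covers `j = 0` and gives the value
  -- 0 for `0 < p ≤ a`.
  p * √(p ^ 2 - a ^ 2) ^ j / √(p ^ 2 - a ^ 2)

theorem measurable_slopeKernel (j : ℕ) : Measurable (fun x : ℝ × ℝ => slopeKernel j x.1 x.2) := by
  unfold slopeKernel
  fun_prop

theorem lintegral_slopeKernel (j : ℕ) {a : ℝ} (ha : 0 ≤ a) (f : ℝ → ℝ≥0∞) :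
    ∫⁻ p in Ioi (0 : ℝ), ENNReal.ofReal (slopeKernel j a p) * f p =
      ∫⁻ t in Ioi (0 : ℝ), ENNReal.ofReal (t ^ j) * f √(a ^ 2 + t ^ 2) := by
  have h1 : ∫⁻ p in Ioi (0 : ℝ), ENNReal.ofReal (slopeKernel j a p) * f p =
      ∫⁻ p in Ioi a, ENNReal.ofReal (slopeKernel j a p) * f p := by
    have h : ∀ p ∈ Ioi (0 : ℝ), ENNReal.ofReal (slopeKernel j a p) * f p =
        (Ioi a).indicator (fun p => ENNReal.ofReal (slopeKernel j a p) * f p) p := by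
      intro p hp
      have hp : 0 < p := hp
      by_cases hpa : a < p
      · rw [indicator_of_mem (show p ∈ Ioi a from hpa)]
      · rw [indicator_of_notMem (show p ∉ Ioi a from hpa), slopeKernel,
          Real.sqrt_eq_zero_of_nonpos (by nlinarith : p ^ 2 - a ^ 2 ≤ 0)]
        simp
    rw [setLIntegral_congr_fun measurableSet_Ioi h, lintegral_indicator measurableSet_Ioi,
      Measure.restrict_restrict measurableSet_Ioi,
      inter_eq_self_of_subset_left (Ioi_subset_Ioi ha)]
  rw [h1, lintegral_Ioi_comp_sqrt _ ha]
  refine setLIntegral_congr_fun measurableSet_Ioi fun t ht => ?_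
  have ht : 0 < t := ht
  have h2 : 0 < √(a ^ 2 + t ^ 2) := Real.sqrt_pos.2 (by positivity)
  rw [← mul_assoc, ← ENNReal.ofReal_mul (by positivity), slopeKernel,
    Real.sq_sqrt (by positivity : (0 : ℝ) ≤ a ^ 2 + t ^ 2), add_sub_cancel_left, Real.sqrt_sq ht.le]
  congr 2
  field_simp

/-- The substitutions `q = c r` and `p = √((τ q)² + t²)` with `τ = s/c` convert section integrals in
`(r, t)` to the planar variables; `c = 1/√(1 + τ²)` recovers the unit direction from the slope. -/
theorem slope_section_le {Φ₁ Φ₂ : ℝ × ℝ → ℝ≥0∞} (hΦ₁ : Measurable Φ₁) (hΦ₂ : Measurable Φ₂)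
    {l j : ℕ} (hsec : ∀ c s : ℝ, 0 < c → 0 ≤ s → c ^ 2 + s ^ 2 = 1 →
      ∫⁻ r in Ioi (0 : ℝ), ENNReal.ofReal (r ^ l) * ∫⁻ t in Ioi (0 : ℝ),
          ENNReal.ofReal (t ^ j) * Φ₁ (c * r, √((s * r) ^ 2 + t ^ 2)) ≤
        ∫⁻ r in Ioi (0 : ℝ), ENNReal.ofReal (r ^ l) * ∫⁻ t in Ioi (0 : ℝ),
          ENNReal.ofReal (t ^ j) * Φ₂ (c * r, √((s * r) ^ 2 + t ^ 2)))
    {τ : ℝ} (hτ : 0 ≤ τ) :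
    ∫⁻ q in Ioi (0 : ℝ), ENNReal.ofReal (q ^ l) * ∫⁻ p in Ioi (0 : ℝ),
        ENNReal.ofReal (slopeKernel j (τ * q) p) * Φ₁ (q, p) ≤
      ∫⁻ q in Ioi (0 : ℝ), ENNReal.ofReal (q ^ l) * ∫⁻ p in Ioi (0 : ℝ),
        ENNReal.ofReal (slopeKernel j (τ * q) p) * Φ₂ (q, p) := by
  set c : ℝ := (√(1 + τ ^ 2))⁻¹ with hc_def
  have hc : 0 < c := inv_pos.2 (Real.sqrt_pos.2 (by positivity))
  have key : ∀ Φ : ℝ × ℝ → ℝ≥0∞, Measurable Φ →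
      ∫⁻ q in Ioi (0 : ℝ), ENNReal.ofReal (q ^ l) * ∫⁻ p in Ioi (0 : ℝ),
        ENNReal.ofReal (slopeKernel j (τ * q) p) * Φ (q, p) =
      (ENNReal.ofReal c * ENNReal.ofReal (c ^ l)) *
      ∫⁻ r in Ioi (0 : ℝ), ENNReal.ofReal (r ^ l) * ∫⁻ t in Ioi (0 : ℝ),
          ENNReal.ofReal (t ^ j) * Φ (c * r, √(((τ * c) * r) ^ 2 + t ^ 2)) := by
    intro Φ hΦ
    rw [lintegral_Ioi_comp_mul_left _ hc, ← lintegral_const_mul]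
    · refine setLIntegral_congr_fun measurableSet_Ioi fun r hr => ?_
      have hr : 0 < r := hr
      rw [lintegral_slopeKernel j (by positivity), mul_pow, ENNReal.ofReal_mul (by positivity)]
      simp only [mul_assoc]
    · refine Measurable.mul (by fun_prop) (Measurable.lintegral_prod_right'
        (f := fun x : ℝ × ℝ => ENNReal.ofReal (x.2 ^ j) *
          Φ (c * x.1, √(((τ * c) * x.1) ^ 2 + x.2 ^ 2))) (by fun_prop))
  rw [key _ hΦ₁, key _ hΦ₂]
  refine mul_le_mul' le_rfl (hsec _ _ hc (by positivity) ?_)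
  rw [mul_pow, hc_def, inv_pow, Real.sq_sqrt (by positivity)]
  field_simp

/-- For `j = 1` the roots cancel and the slope kernel already is `p` times the wedge indicator. For
`j = 0` integrating the inequality over slopes `s` against `τ / (s √(s² - τ²))` produces the
indicator, by `abel_kernel`. -/
theorem wedge_section_le {Φ₁ Φ₂ : ℝ × ℝ → ℝ≥0∞} (hΦ₁ : Measurable Φ₁) (hΦ₂ : Measurable Φ₂)
    {l j : ℕ} (hj : j = 0 ∨ j = 1) (hsec : ∀ τ : ℝ, 0 ≤ τ →
      ∫⁻ q in Ioi (0 : ℝ), ENNReal.ofReal (q ^ l) * ∫⁻ p in Ioi (0 : ℝ),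
          ENNReal.ofReal (slopeKernel j (τ * q) p) * Φ₁ (q, p) ≤
        ∫⁻ q in Ioi (0 : ℝ), ENNReal.ofReal (q ^ l) * ∫⁻ p in Ioi (0 : ℝ),
          ENNReal.ofReal (slopeKernel j (τ * q) p) * Φ₂ (q, p))
    {τ : ℝ} (hτ : 0 ≤ τ) :
    ∫⁻ p in Ioi (0 : ℝ), ∫⁻ q in Ioi (0 : ℝ), ENNReal.ofReal (p ^ j) * (ENNReal.ofReal (q ^ l) *
        ((if τ * q < p then 1 else 0) * Φ₁ (q, p))) ≤
      ∫⁻ p in Ioi (0 : ℝ), ∫⁻ q in Ioi (0 : ℝ), ENNReal.ofReal (p ^ j) * (ENNReal.ofReal (q ^ l) *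
        ((if τ * q < p then 1 else 0) * Φ₂ (q, p))) := by
  have hker : Measurable fun x : ℝ × ℝ => slopeKernel j (τ * x.1) x.2 :=
    (measurable_slopeKernel j).comp (by fun_prop : Measurable fun x : ℝ × ℝ => (τ * x.1, x.2))
  have hker₃ : Measurable fun x : (ℝ × ℝ) × ℝ => slopeKernel j (x.2 * x.1.1) x.1.2 :=
    (measurable_slopeKernel j).comp
      (by fun_prop : Measurable fun x : (ℝ × ℝ) × ℝ => (x.2 * x.1.1, x.1.2))
  have hite : Measurable fun x : ℝ × ℝ => (if τ * x.1 < x.2 then 1 else 0 : ℝ≥0∞) :=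
    Measurable.ite (measurableSet_lt (by fun_prop) (by fun_prop)) measurable_const measurable_const
  have hswap : ∀ Φ : ℝ × ℝ → ℝ≥0∞, Measurable Φ →
      ∫⁻ p in Ioi (0 : ℝ), ∫⁻ q in Ioi (0 : ℝ), ENNReal.ofReal (p ^ j) * (ENNReal.ofReal (q ^ l) *
        ((if τ * q < p then 1 else 0) * Φ (q, p))) =
      ∫⁻ q in Ioi (0 : ℝ), ENNReal.ofReal (q ^ l) * ∫⁻ p in Ioi (0 : ℝ), ENNReal.ofReal (p ^ j) *
        ((if τ * q < p then 1 else 0) * Φ (q, p)) := by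
    intro Φ hΦ
    have hm : Measurable fun x : ℝ × ℝ => (if τ * x.2 < x.1 then 1 else 0 : ℝ≥0∞) :=
      hite.comp measurable_swap
    rw [lintegral_lintegral_swap (by fun_prop)]
    refine setLIntegral_congr_fun measurableSet_Ioi fun q hq => ?_
    have hm' : Measurable fun p : ℝ => (if τ * q < p then 1 else 0 : ℝ≥0∞) :=
      hite.comp measurable_prodMk_left
    have hΦ' : Measurable fun p : ℝ => Φ (q, p) := hΦ.comp measurable_prodMk_left
    rw [← lintegral_const_mul _ (by fun_prop)]
    refine lintegral_congr fun p => ?_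
    ring
  rw [hswap _ hΦ₁, hswap _ hΦ₂]
  -- At `τ = 0` the kernel for `j = 0` is identically 1 on `p > 0`, so that slope joins the case
  -- without averaging.
  by_cases htriv : j = 1 ∨ τ = 0
  · have h1 : ∀ q ∈ Ioi (0 : ℝ), ∀ p ∈ Ioi (0 : ℝ), ENNReal.ofReal (slopeKernel j (τ * q) p) =
        ENNReal.ofReal (p ^ j) * (if τ * q < p then 1 else 0) := by
      intro q hq p hp
      have hq : 0 < q := hq
      have hp : 0 < p := hp
      unfold slopeKernel
      split_ifs with h
      · have h2 : 0 < √(p ^ 2 - (τ * q) ^ 2) := Real.sqrt_pos.2 (by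
          have : 0 ≤ τ * q := by positivity
          nlinarith)
        rcases htriv with rfl | rfl
        · rw [pow_one, mul_div_cancel_right₀ _ h2.ne', pow_one, mul_one]
        · rw [mul_one]
          simp only [zero_mul, ne_eq, OfNat.ofNat_ne_zero, not_false_eq_true, zero_pow, sub_zero,
            Real.sqrt_sq hp.le, mul_div_cancel_left₀ _ hp.ne']
      · rw [Real.sqrt_eq_zero_of_nonpos (by nlinarith : p ^ 2 - (τ * q) ^ 2 ≤ 0)]
        simp
    have h2 : ∀ Φ : ℝ × ℝ → ℝ≥0∞,
        ∫⁻ q in Ioi (0 : ℝ), ENNReal.ofReal (q ^ l) * ∫⁻ p in Ioi (0 : ℝ), ENNReal.ofReal (p ^ j) *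
          ((if τ * q < p then 1 else 0) * Φ (q, p)) =
        ∫⁻ q in Ioi (0 : ℝ), ENNReal.ofReal (q ^ l) * ∫⁻ p in Ioi (0 : ℝ),
          ENNReal.ofReal (slopeKernel j (τ * q) p) * Φ (q, p) := by
      intro Φ
      refine setLIntegral_congr_fun measurableSet_Ioi fun q hq => ?_
      congr 1
      refine setLIntegral_congr_fun measurableSet_Ioi fun p hp => ?_
      rw [h1 q hq p hp, mul_assoc]
    rw [h2, h2]
    exact hsec τ hτ
  · obtain ⟨hj1, hτ0⟩ := not_or.1 htriv
    obtain rfl : j = 0 := hj.resolve_right hj1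
    have hτ : 0 < τ := lt_of_le_of_ne hτ (Ne.symm hτ0)
    have key : ∀ Φ : ℝ × ℝ → ℝ≥0∞, Measurable Φ →
        ENNReal.ofReal (Real.pi / 2) *
        ∫⁻ q in Ioi (0 : ℝ), ENNReal.ofReal (q ^ l) * ∫⁻ p in Ioi (0 : ℝ), ENNReal.ofReal (p ^ 0) *
          ((if τ * q < p then 1 else 0) * Φ (q, p)) =
        ∫⁻ s in Ioi (0 : ℝ), ENNReal.ofReal (τ / (s * √(s ^ 2 - τ ^ 2))) *
          ∫⁻ q in Ioi (0 : ℝ), ENNReal.ofReal (q ^ l) * ∫⁻ p in Ioi (0 : ℝ),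
            ENNReal.ofReal (slopeKernel 0 (s * q) p) * Φ (q, p) := by
      intro Φ hΦ
      have e1 : ∀ s : ℝ, ENNReal.ofReal (τ / (s * √(s ^ 2 - τ ^ 2))) *
          ∫⁻ q in Ioi (0 : ℝ), ENNReal.ofReal (q ^ l) * ∫⁻ p in Ioi (0 : ℝ),
            ENNReal.ofReal (slopeKernel 0 (s * q) p) * Φ (q, p) =
          ∫⁻ q in Ioi (0 : ℝ), ENNReal.ofReal (q ^ l) * ∫⁻ p in Ioi (0 : ℝ),
            ENNReal.ofReal (τ / (s * √(s ^ 2 - τ ^ 2))) *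
              ENNReal.ofReal (slopeKernel 0 (s * q) p) * Φ (q, p) := by
        intro s
        have hk : Measurable fun x : ℝ × ℝ => slopeKernel 0 (s * x.1) x.2 :=
          (measurable_slopeKernel 0).comp
            (by fun_prop : Measurable fun x : ℝ × ℝ => (s * x.1, x.2))
        rw [← lintegral_const_mul]
        · refine lintegral_congr fun q => ?_
          have hk' : Measurable fun p : ℝ => slopeKernel 0 (s * q) p :=
            hk.comp measurable_prodMk_left
          have hΦ' : Measurable fun p : ℝ => Φ (q, p) := hΦ.comp measurable_prodMk_left
          rw [mul_left_comm, ← lintegral_const_mul _ (by fun_prop)]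
          simp only [mul_assoc]
        · exact Measurable.mul (by fun_prop) (Measurable.lintegral_prod_right'
            (f := fun x : ℝ × ℝ => ENNReal.ofReal (slopeKernel 0 (s * x.1) x.2) * Φ x)
            (by fun_prop))
      simp only [e1]
      rw [lintegral_lintegral_swap, ← lintegral_const_mul]
      · refine setLIntegral_congr_fun measurableSet_Ioi fun q hq => ?_
        have hΦ' : Measurable fun p : ℝ => Φ (q, p) := hΦ.comp measurable_prodMk_left
        have hm' : Measurable fun p : ℝ => (if τ * q < p then 1 else 0 : ℝ≥0∞) :=
          hite.comp measurable_prodMk_left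
        have hk₂ : Measurable fun x : ℝ × ℝ => slopeKernel 0 (x.1 * q) x.2 :=
          (measurable_slopeKernel 0).comp
            (by fun_prop : Measurable fun x : ℝ × ℝ => (x.1 * q, x.2))
        rw [lintegral_const_mul]
        · rw [lintegral_lintegral_swap (by fun_prop), mul_left_comm,
            ← lintegral_const_mul _ (by fun_prop)]
          congr 1
          refine setLIntegral_congr_fun measurableSet_Ioi fun p hp => ?_
          have hk₁ : Measurable fun s : ℝ => slopeKernel 0 (s * q) p :=
            hk₂.comp measurable_prodMk_right
          rw [lintegral_mul_const _ (by fun_prop)]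
          have := abel_kernel hτ hp hq
          simp only [slopeKernel, pow_zero, mul_one, ENNReal.ofReal_one, one_mul] at this ⊢
          rw [this, mul_assoc]
        · exact Measurable.lintegral_prod_right'
            (f := fun x : ℝ × ℝ => ENNReal.ofReal (τ / (x.1 * √(x.1 ^ 2 - τ ^ 2))) *
              ENNReal.ofReal (slopeKernel 0 (x.1 * q) x.2) * Φ (q, x.2)) (by fun_prop)
      · exact Measurable.mul (by fun_prop) (Measurable.lintegral_prod_right'
            (f := fun x : ℝ × ℝ => ENNReal.ofReal (x.2 ^ 0) *
              ((if τ * x.1 < x.2 then 1 else 0) * Φ x)) (by fun_prop))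
      · refine Measurable.aemeasurable (Measurable.mul (by fun_prop)
          (Measurable.lintegral_prod_right' (f := fun x : (ℝ × ℝ) × ℝ =>
            ENNReal.ofReal (τ / (x.1.1 * √(x.1.1 ^ 2 - τ ^ 2))) *
              ENNReal.ofReal (slopeKernel 0 (x.1.1 * x.1.2) x.2) * Φ (x.1.2, x.2)) ?_))
        have : Measurable fun x : (ℝ × ℝ) × ℝ => slopeKernel 0 (x.1.1 * x.1.2) x.2 :=
          (measurable_slopeKernel 0).comp
            (by fun_prop : Measurable fun x : (ℝ × ℝ) × ℝ => (x.1.1 * x.1.2, x.2))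
        fun_prop
    refine (ENNReal.mul_le_mul_iff_right (a := ENNReal.ofReal (Real.pi / 2)) ?_ ofReal_ne_top).1 ?_
    · exact (ENNReal.ofReal_pos.2 (by positivity)).ne'
    rw [key _ hΦ₁, key _ hΦ₂]
    exact setLIntegral_mono' measurableSet_Ioi fun s hs => mul_le_mul' le_rfl (hsec s (le_of_lt hs))

/-- Layer-cake decomposition of `g`: each superlevel set of an antitone function is an initial
interval of `(0, ∞)`, so in the variable `q/p` it is a wedge up to a null set. The factor `p^(-N)`
lowers `p^m` to the `p^j` of the wedge integrals. -/
theorem lintegral_antitone_le {Φ₁ Φ₂ : ℝ × ℝ → ℝ≥0∞} (hΦ₁ : Measurable Φ₁) (hΦ₂ : Measurable Φ₂)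
    {g : ℝ → ℝ} (hg : Measurable g) (hanti : AntitoneOn g (Ioi 0)) {l j m N : ℕ} (hN : m = N + j)
    (hsec : ∀ τ : ℝ, 0 ≤ τ →
      ∫⁻ p in Ioi (0 : ℝ), ∫⁻ q in Ioi (0 : ℝ), ENNReal.ofReal (p ^ j) * (ENNReal.ofReal (q ^ l) *
        ((if τ * q < p then 1 else 0) * Φ₁ (q, p))) ≤
      ∫⁻ p in Ioi (0 : ℝ), ∫⁻ q in Ioi (0 : ℝ), ENNReal.ofReal (p ^ j) * (ENNReal.ofReal (q ^ l) *
        ((if τ * q < p then 1 else 0) * Φ₂ (q, p)))) :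
    ∫⁻ p in Ioi (0 : ℝ), ∫⁻ q in Ioi (0 : ℝ), ENNReal.ofReal (p ^ m) * (ENNReal.ofReal (q ^ l) *
        (ENNReal.ofReal (g (q / p)) * ENNReal.ofReal ((p ^ N)⁻¹) * Φ₁ (q, p))) ≤
      ∫⁻ p in Ioi (0 : ℝ), ∫⁻ q in Ioi (0 : ℝ), ENNReal.ofReal (p ^ m) * (ENNReal.ofReal (q ^ l) *
        (ENNReal.ofReal (g (q / p)) * ENNReal.ofReal ((p ^ N)⁻¹) * Φ₂ (q, p))) := by
  have hind : Measurable fun x : ℝ × (ℝ × ℝ) =>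
      (if x.1 < g (x.2.2 / x.2.1) then 1 else 0 : ℝ≥0∞) :=
    Measurable.ite (measurableSet_lt (by fun_prop) (by fun_prop)) measurable_const measurable_const
  have hlayer : ∀ u : ℝ, ENNReal.ofReal (g u) =
      ∫⁻ y in Ioi (0 : ℝ), if y < g u then 1 else 0 := by
    intro u
    have : (fun y : ℝ => if y < g u then (1 : ℝ≥0∞) else 0) = (Iio (g u)).indicator 1 := by
      ext y; simp [indicator]
    rw [this, lintegral_indicator_one measurableSet_Iio, Measure.restrict_apply measurableSet_Iio,
      Iio_inter_Ioi, Real.volume_Ioo, sub_zero]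
  have key : ∀ Φ : ℝ × ℝ → ℝ≥0∞, Measurable Φ →
      ∫⁻ p in Ioi (0 : ℝ), ∫⁻ q in Ioi (0 : ℝ), ENNReal.ofReal (p ^ m) * (ENNReal.ofReal (q ^ l) *
        (ENNReal.ofReal (g (q / p)) * ENNReal.ofReal ((p ^ N)⁻¹) * Φ (q, p))) =
      ∫⁻ y in Ioi (0 : ℝ), ∫⁻ p in Ioi (0 : ℝ), ∫⁻ q in Ioi (0 : ℝ), ENNReal.ofReal (p ^ j) *
        (ENNReal.ofReal (q ^ l) * ((if y < g (q / p) then 1 else 0) * Φ (q, p))) := by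
    intro Φ hΦ
    have hmeas : Measurable fun x : ℝ × (ℝ × ℝ) => ENNReal.ofReal (x.2.1 ^ j) *
        (ENNReal.ofReal (x.2.2 ^ l) * ((if x.1 < g (x.2.2 / x.2.1) then 1 else 0) *
          Φ (x.2.2, x.2.1))) := by fun_prop
    conv_rhs => rw [lintegral_lintegral_swap (by
      exact (Measurable.lintegral_prod_right' (f := fun x : (ℝ × ℝ) × ℝ =>
        ENNReal.ofReal (x.1.2 ^ j) * (ENNReal.ofReal (x.2 ^ l) *
          ((if x.1.1 < g (x.2 / x.1.2) then 1 else 0) * Φ (x.2, x.1.2))))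
        (hmeas.comp (by fun_prop : Measurable fun x : (ℝ × ℝ) × ℝ =>
          (x.1.1, (x.1.2, x.2))))).aemeasurable)]
    refine setLIntegral_congr_fun measurableSet_Ioi fun p hp => ?_
    have hp : 0 < p := hp
    have hmeas' : Measurable fun x : ℝ × ℝ => ENNReal.ofReal (p ^ j) *
      (ENNReal.ofReal (x.2 ^ l) * ((if x.1 < g (x.2 / p) then 1 else 0) * Φ (x.2, p))) :=
      hmeas.comp (by fun_prop : Measurable fun x : ℝ × ℝ => (x.1, (p, x.2)))
    conv_rhs => rw [lintegral_lintegral_swap hmeas'.aemeasurable]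
    refine lintegral_congr fun q => ?_
    have hind' : Measurable fun y : ℝ => (if y < g (q / p) then 1 else 0 : ℝ≥0∞) :=
      hind.comp (by fun_prop : Measurable fun y : ℝ => (y, (p, q)))
    rw [lintegral_const_mul _ (by fun_prop), lintegral_const_mul _ (by fun_prop),
      lintegral_mul_const _ hind', ← hlayer]
    have : ENNReal.ofReal (p ^ j) = ENNReal.ofReal (p ^ m) * ENNReal.ofReal ((p ^ N)⁻¹) := by
      rw [← ENNReal.ofReal_mul (by positivity), hN, pow_add]
      congr 1
      field_simp
    rw [this]
    ring
  rw [key _ hΦ₁, key _ hΦ₂]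
  refine setLIntegral_mono' measurableSet_Ioi fun y _ => ?_
  set S : Set ℝ := {u | 0 < u ∧ y < g u} with hS
  have hlower : ∀ u v, 0 < u → u ≤ v → v ∈ S → u ∈ S := fun u v hu huv hv =>
    ⟨hu, hv.2.trans_le (hanti hu hv.1 huv)⟩
  have hreduce : ∀ τ : ℝ, 0 ≤ τ → (∀ p ∈ Ioi (0 : ℝ), ∀ᵐ q : ℝ, 0 < q →
      (y < g (q / p) ↔ τ * q < p)) → ∀ Φ : ℝ × ℝ → ℝ≥0∞,
      ∫⁻ p in Ioi (0 : ℝ), ∫⁻ q in Ioi (0 : ℝ), ENNReal.ofReal (p ^ j) *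
        (ENNReal.ofReal (q ^ l) * ((if y < g (q / p) then 1 else 0) * Φ (q, p))) =
      ∫⁻ p in Ioi (0 : ℝ), ∫⁻ q in Ioi (0 : ℝ), ENNReal.ofReal (p ^ j) *
        (ENNReal.ofReal (q ^ l) * ((if τ * q < p then 1 else 0) * Φ (q, p))) := by
    intro τ _ h Φ
    refine setLIntegral_congr_fun measurableSet_Ioi fun p hp => ?_
    refine setLIntegral_congr_fun_ae measurableSet_Ioi ?_
    filter_upwards [h p hp] with q hq hq0
    simp only [hq hq0]
  by_cases hemp : S.Nonempty
  swap
  · have h0 : ∀ p ∈ Ioi (0 : ℝ), ∀ q ∈ Ioi (0 : ℝ), ¬ y < g (q / p) := fun p hp q hq h =>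
      hemp ⟨q / p, div_pos hq hp, h⟩
    refine le_of_eq_of_le ?_ zero_le
    rw [setLIntegral_congr_fun measurableSet_Ioi (g := fun _ => 0), lintegral_zero]
    intro p hp
    beta_reduce
    rw [setLIntegral_congr_fun measurableSet_Ioi (g := fun _ => 0), lintegral_zero]
    intro q hq
    simp [h0 p hp q hq]
  by_cases hbdd : BddAbove S
  · have hα : 0 < sSup S := by
      obtain ⟨u, hu⟩ := hemp
      exact hu.1.trans_le (le_csSup hbdd hu)
    have hτ : ∀ p ∈ Ioi (0 : ℝ), ∀ᵐ q : ℝ, 0 < q → (y < g (q / p) ↔ (sSup S)⁻¹ * q < p) := by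
      intro p hp
      have hp : 0 < p := hp
      -- Whether the superlevel set contains its supremum is unknown; the corresponding `q` is a
      -- single point and may be discarded.
      have hne : ∀ᵐ q : ℝ, q ≠ sSup S * p := by simp [ae_iff]
      filter_upwards [hne] with q hq hq0
      have hiff : (sSup S)⁻¹ * q < p ↔ q / p < sSup S := by
        rw [inv_mul_lt_iff₀ hα, div_lt_iff₀ hp]
      rw [hiff]
      constructor
      · intro h
        refine lt_of_le_of_ne (le_csSup hbdd ⟨by positivity, h⟩) fun h' => hq ?_
        rw [← h', div_mul_cancel₀ _ hp.ne']
      · intro h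
        obtain ⟨v, hv, hlt⟩ := exists_lt_of_lt_csSup hemp h
        exact (hlower _ v (by positivity) hlt.le hv).2
    rw [hreduce _ (by positivity) hτ, hreduce _ (by positivity) hτ]
    exact hsec _ (by positivity)
  -- An unbounded superlevel set is all of `(0, ∞)`: the wedge of slope 0.
  · have h0 : ∀ p ∈ Ioi (0 : ℝ), ∀ᵐ q : ℝ, 0 < q → (y < g (q / p) ↔ 0 * q < p) := by
      intro p hp
      refine .of_forall fun q hq => ?_
      obtain ⟨v, hv, hlt⟩ := not_bddAbove_iff.1 hbdd (q / p)
      simp only [zero_mul, show 0 < p from hp, iff_true]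
      exact (hlower _ v (div_pos hq hp) hlt.le hv).2
    rw [hreduce _ le_rfl h0, hreduce _ le_rfl h0]
    exact hsec _ le_rfl

/-! ### Averaging over rotations -/

theorem exists_linearIsometryEquiv_apply_eq {V : Type*} [NormedAddCommGroup V]
    [InnerProductSpace ℝ V] {y y' : V} (h : ‖y‖ = ‖y'‖) : ∃ δ : V ≃ₗᵢ[ℝ] V, δ y = y' :=
  ⟨(ℝ ∙ (y - y'))ᗮ.reflection, Submodule.reflection_sub h⟩

theorem compactSpace_unitary (V : Type*) [NormedAddCommGroup V] [InnerProductSpace ℝ V]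
    [FiniteDimensional ℝ V] : CompactSpace (unitary (V →L[ℝ] V)) := by
  have : ProperSpace (V →L[ℝ] V) := FiniteDimensional.proper ℝ _
  refine isCompact_iff_compactSpace.1 (Metric.isCompact_of_isClosed_isBounded isClosed_unitary ?_)
  refine (Metric.isBounded_closedBall (x := 0) (r := 1)).subset fun u hu => ?_
  rw [mem_closedBall_zero_iff]
  refine ContinuousLinearMap.opNorm_le_bound _ zero_le_one fun x => ?_
  rw [one_mul]
  exact (Unitary.norm_map (⟨u, hu⟩ : unitary (V →L[ℝ] V)) x).le

/-- A probability measure on the orthogonal group under which the law of the image of a vector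
depends only on its norm. -/
theorem exists_random_rotation (V : Type) [NormedAddCommGroup V] [InnerProductSpace ℝ V]
    [FiniteDimensional ℝ V] [MeasurableSpace V] [BorelSpace V] :
    ∃ (Ω : Type) (_ : MeasurableSpace Ω) (P : Measure Ω) (γ : Ω → V ≃ₗᵢ[ℝ] V),
      IsProbabilityMeasure P ∧ Measurable (fun x : Ω × V => γ x.1 x.2) ∧
      ∀ y y' : V, ‖y‖ = ‖y'‖ → ∀ f : V → ℝ≥0∞, ∫⁻ ω, f (γ ω y) ∂P = ∫⁻ ω, f (γ ω y') ∂P := by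
  let _ : MeasurableSpace (unitary (V →L[ℝ] V)) := borel _
  have : BorelSpace (unitary (V →L[ℝ] V)) := ⟨rfl⟩
  have := compactSpace_unitary V
  have : ProperSpace (V →L[ℝ] V) := FiniteDimensional.proper ℝ _
  have : ProperSpace V := FiniteDimensional.proper ℝ _
  have : SecondCountableTopology (unitary (V →L[ℝ] V)) :=
    TopologicalSpace.Subtype.secondCountableTopology _
  -- The random rotation is the inverse of the Haar variable `u`: replacing `u` by `d * u` then
  -- moves the vector before the rotation acts, so left invariance suffices.
  refine ⟨unitary (V →L[ℝ] V), inferInstance, Measure.haarMeasure ⊤,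
    fun u => (Unitary.linearIsometryEquiv u).symm, ⟨?_⟩, ?_, ?_⟩
  · exact Measure.haarMeasure_self (K₀ := ⊤)
  · have h : (fun x : unitary (V →L[ℝ] V) × V => (Unitary.linearIsometryEquiv x.1).symm x.2) =
        fun x => ((star x.1 : unitary (V →L[ℝ] V)) : V →L[ℝ] V) x.2 := rfl
    rw [h]
    refine Continuous.measurable ?_
    fun_prop
  · intro y y' h f
    obtain ⟨δ, hδ⟩ := exists_linearIsometryEquiv_apply_eq h
    set d := Unitary.linearIsometryEquiv.symm δ.symm with hd
    rw [← lintegral_mul_left_eq_self _ d]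
    refine lintegral_congr fun u => congrArg f ?_
    change (Unitary.linearIsometryEquiv (d * u)).symm y = (Unitary.linearIsometryEquiv u).symm y'
    rw [map_mul, hd, MulEquiv.apply_symm_apply, ← hδ, LinearIsometryEquiv.symm_apply_eq,
      LinearIsometryEquiv.coe_mul, Function.comp_apply]
    simp

theorem lintegral_prod_fun_norm {V Z : Type*} [NormedAddCommGroup V] [InnerProductSpace ℝ V]
    [FiniteDimensional ℝ V] [MeasurableSpace V] [BorelSpace V] [Nontrivial V]
    [NormedAddCommGroup Z] [InnerProductSpace ℝ Z]
    [FiniteDimensional ℝ Z] [MeasurableSpace Z] [BorelSpace Z] [Nontrivial Z]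
    {F : ℝ × ℝ → ℝ≥0∞} (hF : Measurable F) :
    ∫⁻ x : V × Z, F (‖x.1‖, ‖x.2‖) =
      ((volume : Measure V).toSphere univ * (volume : Measure Z).toSphere univ) *
      ∫⁻ p in Ioi (0 : ℝ), ENNReal.ofReal (p ^ (Module.finrank ℝ V - 1)) *
        ∫⁻ q in Ioi (0 : ℝ), ENNReal.ofReal (q ^ (Module.finrank ℝ Z - 1)) * F (p, q) := by
  have hm : Measurable fun p : ℝ => ∫⁻ q in Ioi (0 : ℝ),
      ENNReal.ofReal (q ^ (Module.finrank ℝ Z - 1)) * F (p, q) :=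
    Measurable.lintegral_prod_right' (f := fun x : ℝ × ℝ =>
      ENNReal.ofReal (x.2 ^ (Module.finrank ℝ Z - 1)) * F x) (by fun_prop)
  rw [Measure.volume_eq_prod, lintegral_prod _ (by fun_prop)]
  have h1 : ∀ y : V, ∫⁻ z : Z, F (‖y‖, ‖z‖) = (volume : Measure Z).toSphere univ *
      ∫⁻ q in Ioi (0 : ℝ), ENNReal.ofReal (q ^ (Module.finrank ℝ Z - 1)) * F (‖y‖, q) := fun y =>
    lintegral_fun_norm volume (hF.comp measurable_prodMk_left)
  simp only [h1]
  have hm' : Measurable fun y : V => ∫⁻ q in Ioi (0 : ℝ),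
      ENNReal.ofReal (q ^ (Module.finrank ℝ Z - 1)) * F (‖y‖, q) := hm.comp measurable_norm
  rw [lintegral_const_mul _ hm', lintegral_fun_norm volume hm, ← mul_assoc,
    mul_comm (Measure.toSphere _ _)]

/-- Rotation averages in the two factors, expressed through the norms of the components. -/
structure RotationAverage (V Z : Type) [NormedAddCommGroup V] [InnerProductSpace ℝ V]
    [NormedAddCommGroup Z] [InnerProductSpace ℝ Z] [MeasurableSpace V] [MeasurableSpace Z] where
  Ω : Type
  [instΩ : MeasurableSpace Ω]
  P : Measure Ω
  [prob : IsProbabilityMeasure P]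
  γ₁ : Ω → V ≃ₗᵢ[ℝ] V
  γ₂ : Ω → Z ≃ₗᵢ[ℝ] Z
  measurable_γ₁ : Measurable fun x : Ω × V => γ₁ x.1 x.2
  measurable_γ₂ : Measurable fun x : Ω × Z => γ₂ x.1 x.2
  profile : (V × Z → ℝ≥0∞) → ℝ × ℝ → ℝ≥0∞
  measurable_profile : ∀ f, Measurable f → Measurable (profile f)
  lintegral_eq : ∀ f, Measurable f → ∀ y z,
    ∫⁻ ω, f (γ₁ ω y, γ₂ ω z) ∂P = profile f (‖z‖, ‖y‖)

attribute [instance] RotationAverage.instΩ RotationAverage.prob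

theorem nonempty_rotationAverage (V Z : Type) [NormedAddCommGroup V] [InnerProductSpace ℝ V]
    [FiniteDimensional ℝ V] [MeasurableSpace V] [BorelSpace V] [Nontrivial V]
    [NormedAddCommGroup Z] [InnerProductSpace ℝ Z]
    [FiniteDimensional ℝ Z] [MeasurableSpace Z] [BorelSpace Z] [Nontrivial Z] :
    Nonempty (RotationAverage V Z) := by
  obtain ⟨Ω₁, _, P₁, γ₁, _, hm₁, h₁⟩ := exists_random_rotation V
  obtain ⟨Ω₂, _, P₂, γ₂, _, hm₂, h₂⟩ := exists_random_rotation Z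
  obtain ⟨e, he⟩ := exists_norm_eq V zero_le_one
  obtain ⟨e', he'⟩ := exists_norm_eq Z zero_le_one
  have hγ₁ : Measurable fun x : (Ω₁ × Ω₂) × V => γ₁ x.1.1 x.2 :=
    hm₁.comp (by fun_prop : Measurable fun x : (Ω₁ × Ω₂) × V => (x.1.1, x.2))
  have hγ₂ : Measurable fun x : (Ω₁ × Ω₂) × Z => γ₂ x.1.2 x.2 :=
    hm₂.comp (by fun_prop : Measurable fun x : (Ω₁ × Ω₂) × Z => (x.1.2, x.2))
  refine ⟨{
    Ω := Ω₁ × Ω₂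
    P := P₁.prod P₂
    γ₁ := fun ω => γ₁ ω.1
    γ₂ := fun ω => γ₂ ω.2
    measurable_γ₁ := hγ₁
    measurable_γ₂ := hγ₂
    -- Fixed unit vectors turn the average into a function of two radii, in the order `(‖z‖, ‖y‖)`;
    -- hence `x.2` scales `e` and `x.1` scales `e'`.
    profile := fun f x => ∫⁻ ω, f (γ₁ ω.1 (x.2 • e), γ₂ ω.2 (x.1 • e')) ∂(P₁.prod P₂)
    measurable_profile := fun f hf => ?_
    lintegral_eq := fun f hf y z => ?_ }⟩
  · refine Measurable.lintegral_prod_right' (f := fun x : (ℝ × ℝ) × (Ω₁ × Ω₂) =>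
      f (γ₁ x.2.1 (x.1.2 • e), γ₂ x.2.2 (x.1.1 • e'))) (hf.comp (Measurable.prodMk ?_ ?_))
    · exact hm₁.comp (g := fun x : Ω₁ × V => γ₁ x.1 x.2)
        (by fun_prop : Measurable fun x : (ℝ × ℝ) × (Ω₁ × Ω₂) => (x.2.1, x.1.2 • e))
    · exact hm₂.comp (g := fun x : Ω₂ × Z => γ₂ x.1 x.2)
        (by fun_prop : Measurable fun x : (ℝ × ℝ) × (Ω₁ × Ω₂) => (x.2.2, x.1.1 • e'))
  · have hme : ∀ y z, Measurable fun ω : Ω₁ × Ω₂ => f (γ₁ ω.1 y, γ₂ ω.2 z) := fun y z =>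
      hf.comp (Measurable.prodMk
        (hm₁.comp (by fun_prop : Measurable fun ω : Ω₁ × Ω₂ => (ω.1, y)))
        (hm₂.comp (by fun_prop : Measurable fun ω : Ω₁ × Ω₂ => (ω.2, z))))
    rw [lintegral_prod _ (hme _ _).aemeasurable]
    simp only
    have e2 : ∀ ω₁, ∫⁻ ω₂, f (γ₁ ω₁ y, γ₂ ω₂ z) ∂P₂ =
        ∫⁻ ω₂, f (γ₁ ω₁ y, γ₂ ω₂ (‖z‖ • e')) ∂P₂ := fun ω₁ =>
      h₂ z (‖z‖ • e') (by simp [norm_smul, he']) fun z => f (γ₁ ω₁ y, z)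
    simp only [e2]
    rw [lintegral_prod _ (hme _ _).aemeasurable]
    exact h₁ y (‖y‖ • e) (by simp [norm_smul, he]) fun y => ∫⁻ ω₂, f (y, γ₂ ω₂ (‖z‖ • e')) ∂P₂

namespace RotationAverage

theorem measurable_comp
    {V Z : Type} [NormedAddCommGroup V] [InnerProductSpace ℝ V] [MeasurableSpace V]
    [NormedAddCommGroup Z] [InnerProductSpace ℝ Z] [MeasurableSpace Z]
    (avg : RotationAverage V Z) {Y : Type*} [MeasurableSpace Y] {ι₁ : Y → V}
    {ι₂ : Y → Z} (h₁ : Measurable ι₁) (h₂ : Measurable ι₂) {f : V × Z → ℝ≥0∞} (hf : Measurable f) :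
    Measurable fun x : avg.Ω × Y => f (avg.γ₁ x.1 (ι₁ x.2), avg.γ₂ x.1 (ι₂ x.2)) :=
  hf.comp (Measurable.prodMk
    (avg.measurable_γ₁.comp (by fun_prop : Measurable fun x : avg.Ω × Y => (x.1, ι₁ x.2)))
    (avg.measurable_γ₂.comp (by fun_prop : Measurable fun x : avg.Ω × Y => (x.1, ι₂ x.2))))

theorem lintegral_section
    {V Z : Type} [NormedAddCommGroup V] [InnerProductSpace ℝ V] [MeasurableSpace V]
    [NormedAddCommGroup Z] [InnerProductSpace ℝ Z] [MeasurableSpace Z]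
    (avg : RotationAverage V Z) {Y : Type*} [MeasurableSpace Y] (ν : Measure Y)
    [SFinite ν] {ι₁ : Y → V} {ι₂ : Y → Z} (h₁ : Measurable ι₁) (h₂ : Measurable ι₂)
    {f : V × Z → ℝ≥0∞} (hf : Measurable f) :
    ∫⁻ ω, ∫⁻ y, f (avg.γ₁ ω (ι₁ y), avg.γ₂ ω (ι₂ y)) ∂ν ∂avg.P =
      ∫⁻ y, avg.profile f (‖ι₂ y‖, ‖ι₁ y‖) ∂ν := by
  rw [lintegral_lintegral_swap (avg.measurable_comp h₁ h₂ hf).aemeasurable]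
  exact lintegral_congr fun y => avg.lintegral_eq f hf _ _

/-- Each rotation pair preserves both Lebesgue measure and the weight, so the left side may be
averaged over `ω` before Tonelli is applied. -/
theorem lintegral_mul_weight
    {V Z : Type} [NormedAddCommGroup V] [InnerProductSpace ℝ V]
    [FiniteDimensional ℝ V] [MeasurableSpace V] [BorelSpace V]
    [NormedAddCommGroup Z] [InnerProductSpace ℝ Z]
    [FiniteDimensional ℝ Z] [MeasurableSpace Z] [BorelSpace Z]
    (avg : RotationAverage V Z) {f : V × Z → ℝ≥0∞} (hf : Measurable f)
    {w : ℝ × ℝ → ℝ≥0∞} (hw : Measurable w) :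
    ∫⁻ x, f x * w (‖x.2‖, ‖x.1‖) =
      ∫⁻ x : V × Z, avg.profile f (‖x.2‖, ‖x.1‖) * w (‖x.2‖, ‖x.1‖) := by
  have hinv : ∀ ω, ∫⁻ x : V × Z, f (avg.γ₁ ω x.1, avg.γ₂ ω x.2) * w (‖x.2‖, ‖x.1‖) =
      ∫⁻ x, f x * w (‖x.2‖, ‖x.1‖) := by
    intro ω
    have hmp : MeasurePreserving (fun x : V × Z => (avg.γ₁ ω x.1, avg.γ₂ ω x.2)) volume volume :=
      (avg.γ₁ ω).measurePreserving.prod (avg.γ₂ ω).measurePreserving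
    rw [← hmp.lintegral_comp (f := fun x => f x * w (‖x.2‖, ‖x.1‖)) (by fun_prop)]
    simp
  have h := avg.measurable_comp measurable_fst measurable_snd hf
  calc _ = ∫⁻ ω, ∫⁻ x : V × Z, f (avg.γ₁ ω x.1, avg.γ₂ ω x.2) * w (‖x.2‖, ‖x.1‖) ∂volume ∂avg.P := by
        simp [hinv]
    _ = ∫⁻ x : V × Z, ∫⁻ ω, f (avg.γ₁ ω x.1, avg.γ₂ ω x.2) * w (‖x.2‖, ‖x.1‖) ∂avg.P ∂volume :=
        lintegral_lintegral_swap (Measurable.aemeasurable (h.mul (by fun_prop)))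
    _ = _ := by
        refine lintegral_congr fun x => ?_
        have hx : Measurable fun ω => f (avg.γ₁ ω x.1, avg.γ₂ ω x.2) :=
          h.comp measurable_prodMk_right
        rw [lintegral_mul_const _ hx, avg.lintegral_eq f hf]

end RotationAverage

/-! ### Coordinates adapted to the splitting -/

/-- The isometry `ℝ^m ⊕ ℝ^ℓ ≃ ℝ^(m+ℓ)` that concatenates coordinates. -/
noncomputable def splitCoords (m ℓ : ℕ) : WithLp 2 (E m × E ℓ) ≃ₗᵢ[ℝ] E (m + ℓ) :=
  (PiLp.sumPiLpEquivProdLpPiLp (𝕜 := ℝ) 2 (fun _ : Fin m ⊕ Fin ℓ => ℝ)).symm.trans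
    (LinearIsometryEquiv.piLpCongrLeft 2 ℝ ℝ finSumFinEquiv)

theorem splitCoords_castAdd {m ℓ : ℕ} (x : WithLp 2 (E m × E ℓ)) (j : Fin m) :
    splitCoords m ℓ x (Fin.castAdd ℓ j) = x.fst j := by
  simp [splitCoords, LinearIsometryEquiv.piLpCongrLeft_apply, Equiv.piCongrLeft'_apply]

theorem splitCoords_natAdd {m ℓ : ℕ} (x : WithLp 2 (E m × E ℓ)) (j : Fin ℓ) :
    splitCoords m ℓ x (Fin.natAdd m j) = x.snd j := by
  simp [splitCoords, LinearIsometryEquiv.piLpCongrLeft_apply, Equiv.piCongrLeft'_apply]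

theorem splitCoords_single_fst {m ℓ : ℕ} (j : Fin m) :
    splitCoords m ℓ (WithLp.toLp 2 (EuclideanSpace.single j 1, 0)) =
      EuclideanSpace.single (Fin.castAdd ℓ j) 1 := by
  ext k
  induction k using Fin.addCases with
  | left k => rw [splitCoords_castAdd]; simp
  | right k => rw [splitCoords_natAdd]; simp [Fin.ext_iff]; omega

theorem splitCoords_single_snd {m ℓ : ℕ} (j : Fin ℓ) :
    splitCoords m ℓ (WithLp.toLp 2 (0, EuclideanSpace.single j 1)) =
      EuclideanSpace.single (Fin.natAdd m j) 1 := by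
  ext k
  induction k using Fin.addCases with
  | left k => rw [splitCoords_castAdd]; simp [Fin.ext_iff]; omega
  | right k => rw [splitCoords_natAdd]; simp

theorem span_single_eq_top (d : ℕ) :
    Submodule.span ℝ (range fun j : Fin d => (EuclideanSpace.single j (1 : ℝ) : E d)) = ⊤ := by
  have h := (EuclideanSpace.basisFun (Fin d) ℝ).toBasis.span_eq
  rw [OrthonormalBasis.coe_toBasis] at h
  have he : ⇑(EuclideanSpace.basisFun (Fin d) ℝ) = fun j => EuclideanSpace.single j (1 : ℝ) :=
    funext fun j => EuclideanSpace.basisFun_apply _ _ j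
  rwa [he] at h

theorem lastCoords_eq (m ℓ : ℕ) : lastCoords (m + ℓ) ℓ =
    LinearMap.range ((splitCoords m ℓ).toLinearEquiv.toLinearMap ∘ₗ
      (WithLp.linearEquiv 2 ℝ (E m × E ℓ)).symm.toLinearMap ∘ₗ LinearMap.inr ℝ (E m) (E ℓ)) := by
  rw [LinearMap.range_eq_map, ← span_single_eq_top ℓ, Submodule.map_span, ← range_comp, lastCoords]
  congr 1
  ext v
  constructor
  · rintro ⟨j, hj, rfl⟩
    induction j using Fin.addCases with
    | left j => simp only [Fin.val_castAdd] at hj; omega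
    | right j => exact ⟨j, splitCoords_single_snd j⟩
  · rintro ⟨j, rfl⟩
    exact ⟨Fin.natAdd m j, by simp only [Fin.val_natAdd]; omega, splitCoords_single_snd j⟩

theorem firstCoords_eq (m ℓ : ℕ) : firstCoords (m + ℓ) ℓ =
    LinearMap.range ((splitCoords m ℓ).toLinearEquiv.toLinearMap ∘ₗ
      (WithLp.linearEquiv 2 ℝ (E m × E ℓ)).symm.toLinearMap ∘ₗ LinearMap.inl ℝ (E m) (E ℓ)) := by
  rw [LinearMap.range_eq_map, ← span_single_eq_top m, Submodule.map_span, ← range_comp, firstCoords]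
  congr 1
  ext v
  constructor
  · rintro ⟨j, hj, rfl⟩
    induction j using Fin.addCases with
    | left j => exact ⟨j, splitCoords_single_fst j⟩
    | right j => simp only [Fin.val_natAdd] at hj; omega
  · rintro ⟨j, rfl⟩
    exact ⟨Fin.castAdd ℓ j, by simp, splitCoords_single_fst j⟩

theorem mem_lastCoords {m ℓ : ℕ} {x : E (m + ℓ)} : x ∈ lastCoords (m + ℓ) ℓ ↔
    ∃ z : E ℓ, splitCoords m ℓ (WithLp.toLp 2 (0, z)) = x := by
  rw [lastCoords_eq]; rfl

theorem mem_firstCoords {m ℓ : ℕ} {x : E (m + ℓ)} : x ∈ firstCoords (m + ℓ) ℓ ↔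
    ∃ y : E m, splitCoords m ℓ (WithLp.toLp 2 (y, 0)) = x := by
  rw [firstCoords_eq]; rfl

theorem finrank_lastCoords (m ℓ : ℕ) : Module.finrank ℝ (lastCoords (m + ℓ) ℓ) = ℓ := by
  rw [lastCoords_eq, LinearMap.finrank_range_of_inj, finrank_euclideanSpace_fin]
  intro z z' h
  simpa using h

theorem inner_splitCoords {m ℓ : ℕ} (x x' : WithLp 2 (E m × E ℓ)) :
    inner ℝ (splitCoords m ℓ x) (splitCoords m ℓ x') =
      inner ℝ x.fst x'.fst + inner ℝ x.snd x'.snd := by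
  rw [LinearIsometryEquiv.inner_map_map, WithLp.prod_inner_apply]
  rfl

theorem starProjection_lastCoords {m ℓ : ℕ} (x : WithLp 2 (E m × E ℓ)) :
    (lastCoords (m + ℓ) ℓ).starProjection (splitCoords m ℓ x) =
      splitCoords m ℓ (WithLp.toLp 2 (0, x.snd)) := by
  have hmem : splitCoords m ℓ (WithLp.toLp 2 (0, x.snd)) ∈ lastCoords (m + ℓ) ℓ :=
    mem_lastCoords.2 ⟨_, rfl⟩
  refine Submodule.eq_starProjection_of_mem_of_inner_eq_zero hmem ?_
  intro w hw
  obtain ⟨z, rfl⟩ := mem_lastCoords.1 hw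
  rw [← map_sub, inner_splitCoords]
  simp

/-- The orthogonal transformation of `ℝ^m ⊕ ℝ^ℓ` with diagonal blocks `γ₁`, `γ₂`. -/
noncomputable def blockDiagonal {V Z : Type*} [NormedAddCommGroup V] [InnerProductSpace ℝ V]
    [NormedAddCommGroup Z] [InnerProductSpace ℝ Z]
    (γ₁ : V ≃ₗᵢ[ℝ] V) (γ₂ : Z ≃ₗᵢ[ℝ] Z) : WithLp 2 (V × Z) ≃ₗᵢ[ℝ] WithLp 2 (V × Z) where
  toLinearEquiv := (WithLp.linearEquiv 2 ℝ (V × Z)).trans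
    ((γ₁.toLinearEquiv.prodCongr γ₂.toLinearEquiv).trans (WithLp.linearEquiv 2 ℝ (V × Z)).symm)
  norm_map' x := by
    rw [WithLp.prod_norm_eq_of_L2, WithLp.prod_norm_eq_of_L2]
    simp

theorem blockDiagonal_apply {V Z : Type*} [NormedAddCommGroup V] [InnerProductSpace ℝ V]
    [NormedAddCommGroup Z] [InnerProductSpace ℝ Z]
    (γ₁ : V ≃ₗᵢ[ℝ] V) (γ₂ : Z ≃ₗᵢ[ℝ] Z) (x : WithLp 2 (V × Z)) :
    blockDiagonal γ₁ γ₂ x = WithLp.toLp 2 (γ₁ x.fst, γ₂ x.snd) := rfl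

theorem mem_splitCoords_iff {m ℓ : ℕ} {A : Set (E (m + ℓ))} (hA : IsBlockSymmetric ℓ A)
    (γ₁ : E m ≃ₗᵢ[ℝ] E m) (γ₂ : E ℓ ≃ₗᵢ[ℝ] E ℓ) (x : WithLp 2 (E m × E ℓ)) :
    splitCoords m ℓ (blockDiagonal γ₁ γ₂ x) ∈ A ↔ splitCoords m ℓ x ∈ A := by
  set γ := (splitCoords m ℓ).symm.trans ((blockDiagonal γ₁ γ₂).trans (splitCoords m ℓ)) with hγ
  have hmem : γ ∈ blockOrthogonal (m + ℓ) ℓ := by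
    constructor
    · intro v hv
      obtain ⟨y, rfl⟩ := mem_firstCoords.1 hv
      exact mem_firstCoords.2 ⟨γ₁ y, by simp [hγ, blockDiagonal_apply]⟩
    · intro v hv
      obtain ⟨z, rfl⟩ := mem_lastCoords.1 hv
      exact mem_lastCoords.2 ⟨γ₂ z, by simp [hγ, blockDiagonal_apply]⟩
  have h : splitCoords m ℓ (blockDiagonal γ₁ γ₂ x) = γ (splitCoords m ℓ x) := by simp [hγ]
  rw [h]
  nth_rewrite 1 [← hA γ hmem]
  exact γ.injective.mem_set_image

theorem mem_splitCoords_iff_of_norm_eq {m ℓ : ℕ} {A : Set (E (m + ℓ))} (hA : IsBlockSymmetric ℓ A)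
    {y y' : E m} {z z' : E ℓ} (hy : ‖y‖ = ‖y'‖) (hz : ‖z‖ = ‖z'‖) :
    splitCoords m ℓ (WithLp.toLp 2 (y, z)) ∈ A ↔ splitCoords m ℓ (WithLp.toLp 2 (y', z')) ∈ A := by
  obtain ⟨γ₁, rfl⟩ := exists_linearIsometryEquiv_apply_eq hy
  obtain ⟨γ₂, rfl⟩ := exists_linearIsometryEquiv_apply_eq hz
  exact (mem_splitCoords_iff hA γ₁ γ₂ (WithLp.toLp 2 (y, z))).symm

/-! ### Subspaces with equal canonical angles -/

/-- The hypothesis says that the compression is the scalar `κ`; testing it on a unit eigenvector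
shows that every eigenvalue is `κ`. -/
theorem canonicalAngles_eq_of_inner {n : ℕ} {U V : Submodule ℝ (E n)} {κ : ℝ}
    (h : ∀ x ∈ U, ∀ y ∈ U, inner ℝ (V.starProjection x) y = κ * inner ℝ x y)
    (j k : Fin (Module.finrank ℝ U)) : canonicalAngles U V j = canonicalAngles U V k := by
  have key : ∀ j, (compression_isSymmetric U V).eigenvalues rfl j = κ := by
    intro j
    set v := (compression_isSymmetric U V).eigenvectorBasis rfl j with hv
    have h1 : inner ℝ (compression U V v) v =
        (compression_isSymmetric U V).eigenvalues rfl j * inner ℝ v v := by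
      rw [hv, (compression_isSymmetric U V).apply_eigenvectorBasis, real_inner_smul_left]
      rfl
    have h2 : inner ℝ v v = (1 : ℝ) := by
      rw [real_inner_self_eq_norm_sq, hv, OrthonormalBasis.norm_eq_one, one_pow]
    rw [inner_compression, h v v.2 v v.2, ← Submodule.coe_inner, h2, mul_one, mul_one] at h1
    exact h1.symm
  simp only [canonicalAngles, key]

theorem sectionVolume_range {n : ℕ} {Y : Type*} [NormedAddCommGroup Y] [InnerProductSpace ℝ Y]
    [FiniteDimensional ℝ Y] [MeasurableSpace Y] [BorelSpace Y] (ι : Y →ₗᵢ[ℝ] E n)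
    {K : Set (E n)} (hK : MeasurableSet K) :
    sectionVolume K (LinearMap.range ι.toLinearMap) = volume {y | ι y ∈ K} := by
  have h := (ι.equivRange).measurePreserving
  exact (h.measure_preimage (s := {x | (x : E n) ∈ K})
    (measurable_subtype_coe hK).nullMeasurableSet).symm

/-- The diagonal embedding `x ↦ (s U x, c V x)`. -/
noncomputable def diagonalEmbedding {X V Z : Type*} [NormedAddCommGroup X] [InnerProductSpace ℝ X]
    [NormedAddCommGroup V] [InnerProductSpace ℝ V] [NormedAddCommGroup Z] [InnerProductSpace ℝ Z]
    (S : X →ₗᵢ[ℝ] V) (T : X →ₗᵢ[ℝ] Z) {c s : ℝ} (hcs : c ^ 2 + s ^ 2 = 1) :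
    X →ₗᵢ[ℝ] WithLp 2 (V × Z) where
  toLinearMap := (WithLp.linearEquiv 2 ℝ (V × Z)).symm.toLinearMap ∘ₗ
    (s • S.toLinearMap).prod (c • T.toLinearMap)
  norm_map' x := by
    rw [WithLp.prod_norm_eq_of_L2]
    rw [Real.sqrt_eq_iff_eq_sq (by positivity) (norm_nonneg x)]
    change ‖s • S x‖ ^ 2 + ‖c • T x‖ ^ 2 = _
    simp only [norm_smul, LinearIsometry.norm_map, Real.norm_eq_abs, mul_pow, sq_abs]
    linear_combination ‖x‖ ^ 2 * hcs

theorem diagonalEmbedding_apply {X V Z : Type*} [NormedAddCommGroup X] [InnerProductSpace ℝ X]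
    [NormedAddCommGroup V] [InnerProductSpace ℝ V] [NormedAddCommGroup Z] [InnerProductSpace ℝ Z]
    (S : X →ₗᵢ[ℝ] V) (T : X →ₗᵢ[ℝ] Z) {c s : ℝ} (hcs : c ^ 2 + s ^ 2 = 1) (x : X) :
    diagonalEmbedding S T hcs x = WithLp.toLp 2 (s • S x, c • T x) := rfl

/-- The embedding `(z, w) ↦ (S (s z, w), c z)`. -/
noncomputable def slopeEmbedding {V W Z : Type*} [NormedAddCommGroup V] [InnerProductSpace ℝ V]
    [NormedAddCommGroup W] [InnerProductSpace ℝ W] [NormedAddCommGroup Z] [InnerProductSpace ℝ Z]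
    (S : WithLp 2 (Z × W) →ₗᵢ[ℝ] V) {c s : ℝ} (hcs : c ^ 2 + s ^ 2 = 1) :
    WithLp 2 (Z × W) →ₗᵢ[ℝ] WithLp 2 (V × Z) where
  toLinearMap := (WithLp.linearEquiv 2 ℝ (V × Z)).symm.toLinearMap ∘ₗ
    ((S.toLinearMap ∘ₗ (WithLp.linearEquiv 2 ℝ (Z × W)).symm.toLinearMap ∘ₗ
      (s • LinearMap.fst ℝ Z W).prod (LinearMap.snd ℝ Z W)).prod (c • LinearMap.fst ℝ Z W)) ∘ₗ
    (WithLp.linearEquiv 2 ℝ (Z × W)).toLinearMap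
  norm_map' x := by
    rw [WithLp.prod_norm_eq_of_L2, WithLp.prod_norm_eq_of_L2 x]
    congr 1
    change ‖S (WithLp.toLp 2 (s • x.fst, x.snd))‖ ^ 2 + ‖c • x.fst‖ ^ 2 = _
    rw [LinearIsometry.norm_map, WithLp.prod_norm_sq_eq_of_L2]
    simp only [WithLp.toLp_fst, WithLp.toLp_snd, norm_smul, Real.norm_eq_abs, mul_pow, sq_abs]
    linear_combination ‖x.fst‖ ^ 2 * hcs

theorem slopeEmbedding_apply {V W Z : Type*} [NormedAddCommGroup V] [InnerProductSpace ℝ V]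
    [NormedAddCommGroup W] [InnerProductSpace ℝ W] [NormedAddCommGroup Z] [InnerProductSpace ℝ Z]
    (S : WithLp 2 (Z × W) →ₗᵢ[ℝ] V) {c s : ℝ} (hcs : c ^ 2 + s ^ 2 = 1) (x : WithLp 2 (Z × W)) :
    slopeEmbedding S hcs x = WithLp.toLp 2 (S (WithLp.toLp 2 (s • x.fst, x.snd)), c • x.fst) := rfl

/-- Every `E a` embeds isometrically into `E b` for `a ≤ b`. -/
theorem nonempty_linearIsometry {a b : ℕ} (h : a ≤ b) : Nonempty (E a →ₗᵢ[ℝ] E b) := by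
  obtain ⟨d, rfl⟩ := Nat.exists_eq_add_of_le h
  refine ⟨(splitCoords a d).toLinearIsometry.comp
    { toLinearMap := (WithLp.linearEquiv 2 ℝ (E a × E d)).symm.toLinearMap ∘ₗ
        LinearMap.inl ℝ (E a) (E d)
      norm_map' := fun x => ?_ }⟩
  rw [WithLp.prod_norm_eq_of_L2]
  simp

/-- Projecting onto `ℝ^ℓ` keeps only the component `c T x`, and `T` is isometric, so the compression
to the subspace is the scalar `c²`. -/
theorem range_mem_equalAngleGrassmannian_of_le {m ℓ i : ℕ} (hi : i ≤ ℓ) (S : E i →ₗᵢ[ℝ] E m)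
    (T : E i →ₗᵢ[ℝ] E ℓ) {c s : ℝ} (hcs : c ^ 2 + s ^ 2 = 1) :
    LinearMap.range ((splitCoords m ℓ).toLinearIsometry.comp
      (diagonalEmbedding S T hcs)).toLinearMap ∈ equalAngleGrassmannian (m + ℓ) i ℓ := by
  have hrank : Module.finrank ℝ (LinearMap.range ((splitCoords m ℓ).toLinearIsometry.comp
      (diagonalEmbedding S T hcs)).toLinearMap) = i := by
    rw [LinearMap.finrank_range_of_inj (LinearIsometry.injective _), finrank_euclideanSpace_fin]
  refine ⟨hrank, ?_⟩
  rw [HasEqualCanonicalAngles, if_pos (by rw [hrank, finrank_lastCoords]; exact hi)]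
  refine canonicalAngles_eq_of_inner (κ := c ^ 2) ?_
  rintro _ ⟨x, rfl⟩ _ ⟨x', rfl⟩
  change inner ℝ ((lastCoords (m + ℓ) ℓ).starProjection
    (splitCoords m ℓ (diagonalEmbedding S T hcs x))) (splitCoords m ℓ (diagonalEmbedding S T hcs x'))
    = c ^ 2 * inner ℝ (splitCoords m ℓ (diagonalEmbedding S T hcs x))
      (splitCoords m ℓ (diagonalEmbedding S T hcs x'))
  rw [starProjection_lastCoords, inner_splitCoords, LinearIsometryEquiv.inner_map_map,
    LinearIsometry.inner_map_map]
  simp only [diagonalEmbedding_apply, WithLp.toLp_fst, WithLp.toLp_snd, inner_zero_left, zero_add, real_inner_smul_left,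
    real_inner_smul_right, LinearIsometry.inner_map_map]
  ring

/-- Here `ℝ^ℓ` is the smaller space. The projection of `(0, a)` to the subspace is the image of `(c
γ⁻¹ a, 0)`, whose last component is `c² a`; the compression to `ℝ^ℓ` is again `c²`. -/
theorem range_mem_equalAngleGrassmannian_of_lt {m ℓ k : ℕ} (hk : 0 < k)
    (S : WithLp 2 (E ℓ × E k) →ₗᵢ[ℝ] E m) (γ : E ℓ ≃ₗᵢ[ℝ] E ℓ) {c s : ℝ} (hcs : c ^ 2 + s ^ 2 = 1)
    (ι : WithLp 2 (E ℓ × E k) →ₗᵢ[ℝ] WithLp 2 (E m × E ℓ))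
    (hι : ∀ x, ι x = blockDiagonal (LinearIsometryEquiv.refl ℝ _) γ (slopeEmbedding S hcs x)) :
    LinearMap.range ((splitCoords m ℓ).toLinearIsometry.comp ι).toLinearMap ∈
      equalAngleGrassmannian (m + ℓ) (ℓ + k) ℓ := by
  have hrank : Module.finrank ℝ (LinearMap.range
      ((splitCoords m ℓ).toLinearIsometry.comp ι).toLinearMap) = ℓ + k := by
    rw [LinearMap.finrank_range_of_inj (LinearIsometry.injective _),
      (splitCoords ℓ k).toLinearEquiv.finrank_eq, finrank_euclideanSpace_fin]
  refine ⟨hrank, ?_⟩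
  rw [HasEqualCanonicalAngles, if_neg (by rw [hrank, finrank_lastCoords]; omega)]
  refine canonicalAngles_eq_of_inner (κ := c ^ 2) ?_
  intro x hx x' hx'
  obtain ⟨a, rfl⟩ := mem_lastCoords.1 hx
  obtain ⟨b, rfl⟩ := mem_lastCoords.1 hx'
  have hproj : (LinearMap.range
      ((splitCoords m ℓ).toLinearIsometry.comp ι).toLinearMap).starProjection
        (splitCoords m ℓ (WithLp.toLp 2 (0, a))) =
      splitCoords m ℓ (ι (WithLp.toLp 2 (c • γ.symm a, 0))) := by
    have hmem : splitCoords m ℓ (ι (WithLp.toLp 2 (c • γ.symm a, 0))) ∈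
        LinearMap.range ((splitCoords m ℓ).toLinearIsometry.comp ι).toLinearMap := ⟨_, rfl⟩
    refine Submodule.eq_starProjection_of_mem_of_inner_eq_zero hmem ?_
    rintro _ ⟨y, rfl⟩
    change inner ℝ (_ - _) (splitCoords m ℓ (ι y)) = 0
    rw [inner_sub_left, LinearIsometryEquiv.inner_map_map, LinearIsometryEquiv.inner_map_map,
      LinearIsometry.inner_map_map, WithLp.prod_inner_apply, WithLp.prod_inner_apply, hι,
      blockDiagonal_apply, slopeEmbedding_apply]
    have h : inner ℝ a (γ y.fst) = inner ℝ (γ.symm a) y.fst := by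
      rw [← γ.inner_map_map (γ.symm a), γ.apply_symm_apply]
    simp [real_inner_smul_left, real_inner_smul_right, h]
  rw [hproj, inner_splitCoords, inner_splitCoords, hι, blockDiagonal_apply, slopeEmbedding_apply]
  simp [real_inner_smul_left]
  ring

theorem nontrivial_E {d : ℕ} (hd : 0 < d) : Nontrivial (E d) :=
  Module.nontrivial_of_finrank_pos (R := ℝ) (by rw [finrank_euclideanSpace_fin]; exact hd)

theorem toSphere_univ_ne_zero {V : Type*} [NormedAddCommGroup V] [InnerProductSpace ℝ V]
    [FiniteDimensional ℝ V] [MeasurableSpace V] [BorelSpace V] [Nontrivial V] :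
    (volume : Measure V).toSphere univ ≠ 0 :=
  Measure.measure_univ_ne_zero.2 (Measure.toSphere_ne_zero _)

/-! ### Radial functions as weights -/

section Radial

variable {n : ℕ} {A : Set (E n)}

theorem IsStarBody.zero_mem (hA : IsStarBody A) : (0 : E n) ∈ A := by
  obtain ⟨x, hx⟩ := hA.interior_nonempty
  simpa using hA.smul_mem 0 ⟨le_rfl, zero_le_one⟩ x (interior_subset hx)

theorem IsStarBody.zero_mem_radialSet (hA : IsStarBody A) (x : E n) :
    (0 : ℝ) ∈ {t : ℝ | 0 ≤ t ∧ t • x ∈ A} :=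
  ⟨le_rfl, by simpa using hA.zero_mem⟩

theorem radialFunction_nonneg (A : Set (E n)) (x : E n) : 0 ≤ radialFunction A x :=
  Real.sSup_nonneg fun _ ht => ht.1

theorem IsStarBody.exists_bound (hA : IsStarBody A) : ∃ r : ℝ, 0 < r ∧ A ⊆ Metric.ball 0 r ∧
    ∀ x ≠ 0, ∀ t ∈ {t : ℝ | 0 ≤ t ∧ t • x ∈ A}, t ≤ r / ‖x‖ := by
  obtain ⟨r, hr0, hr⟩ := hA.isCompact.isBounded.subset_ball_lt 0 0
  refine ⟨r, hr0, hr, fun x hx t ht => ?_⟩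
  have h := mem_ball_zero_iff.1 (hr ht.2)
  rw [norm_smul, Real.norm_eq_abs, abs_of_nonneg ht.1] at h
  rw [le_div_iff₀ (norm_pos_iff.2 hx)]
  exact h.le

theorem IsStarBody.bddAbove (hA : IsStarBody A) {x : E n} (hx : x ≠ 0) :
    BddAbove {t : ℝ | 0 ≤ t ∧ t • x ∈ A} := by
  obtain ⟨r, -, -, hr⟩ := hA.exists_bound
  exact ⟨r / ‖x‖, hr x hx⟩

theorem IsStarBody.one_le_radialFunction (hA : IsStarBody A) {x : E n} (hx : x ≠ 0) (hxA : x ∈ A) :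
    1 ≤ radialFunction A x :=
  le_csSup (hA.bddAbove hx) ⟨zero_le_one, by simpa using hxA⟩

theorem IsStarBody.radialFunction_le_one (hA : IsStarBody A) {x : E n} (hxA : x ∉ A) :
    radialFunction A x ≤ 1 := by
  refine Real.sSup_le (fun t ht => ?_) zero_le_one
  by_contra! h
  have ht0 : 0 < t := zero_lt_one.trans h
  apply hxA
  have := hA.smul_mem t⁻¹ ⟨by positivity, inv_le_one_of_one_le₀ h.le⟩ _ ht.2
  rwa [inv_smul_smul₀ ht0.ne'] at this

/-- At the origin the admissible `t` form `[0, ∞)` or the empty set, and the real `sSup` defaults to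
0 in both cases. -/
theorem radialFunction_zero : radialFunction A 0 = 0 := by
  by_cases h : (0 : E n) ∈ A
  · have : {t : ℝ | 0 ≤ t ∧ t • (0 : E n) ∈ A} = Ici 0 := by ext; simp [h]
    rw [radialFunction, this, Real.sSup_of_not_bddAbove (not_bddAbove_Ici 0)]
  · have : {t : ℝ | 0 ≤ t ∧ t • (0 : E n) ∈ A} = ∅ := by ext; simp [h]
    rw [radialFunction, this, Real.sSup_empty]

theorem radialFunction_smul (A : Set (E n)) {c : ℝ} (hc : 0 < c) (x : E n) :
    radialFunction A (c • x) = c⁻¹ * radialFunction A x := by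
  rw [radialFunction, radialFunction, ← smul_eq_mul, ← Real.sSup_smul_of_nonneg (by positivity)]
  congr 1
  ext t
  rw [mem_smul_set_iff_inv_smul_mem₀ (by positivity), inv_inv]
  simp only [mem_ofPred_eq, smul_eq_mul, smul_smul, mul_comm c t]
  refine and_congr_left fun _ => ⟨fun h => by positivity, fun h => ?_⟩
  exact nonneg_of_mul_nonneg_left h hc

theorem IsStarBody.continuousOn_radialFunction_compl (hA : IsStarBody A) :
    ContinuousOn (radialFunction A) {0}ᶜ := by
  have h : ∀ x ∈ ({0}ᶜ : Set (E n)), radialFunction A x =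
      ‖x‖⁻¹ * radialFunction A (‖x‖⁻¹ • x) := by
    intro x hx
    have hx : 0 < ‖x‖ := norm_pos_iff.2 hx
    rw [radialFunction_smul A (by positivity), inv_inv, inv_mul_cancel_left₀ hx.ne']
  have hinv : ContinuousOn (fun x : E n => ‖x‖⁻¹) {0}ᶜ :=
    continuous_norm.continuousOn.inv₀ fun x hx => norm_ne_zero_iff.2 hx
  refine ContinuousOn.congr (hinv.mul (hA.continuousOn_radialFunction.comp
    (hinv.smul continuousOn_id) fun x hx => ?_)) h
  simp only [mem_sphere_zero_iff_norm]
  exact norm_smul_inv_norm (𝕜 := ℝ) hx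

theorem IsStarBody.measurable_radialFunction (hA : IsStarBody A) : Measurable (radialFunction A) :=
  measurable_of_continuousOn_compl_singleton 0 hA.continuousOn_radialFunction_compl

/-- If `A` lies in a ball of radius `r`, the radial function is at most `r / ‖x‖`, whose `N`-th
power is integrable near 0 because `N < n`. -/
theorem IsStarBody.lintegral_radialFunction_pow_ne_top (hA : IsStarBody A) {N : ℕ} (hN : N < n) :
    ∫⁻ x in A, ENNReal.ofReal (radialFunction A x ^ N) ≠ ∞ := by
  have := nontrivial_E (pos_of_gt hN)
  obtain ⟨r, hr0, hr, hbound⟩ := hA.exists_bound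
  have hint : IntegrableOn (fun x : E n => (r / ‖x‖) ^ N) (Metric.ball 0 r) := by
    rw [integrableOn_fun_norm_addHaar volume (f := fun t => (r / t) ^ N), finrank_euclideanSpace_fin]
    have h1 : IntegrableOn (fun y : ℝ => r ^ N * y ^ (n - 1 - N)) (Ioo 0 r) :=
      (Continuous.integrableOn_Icc (by fun_prop)).mono_set Ioo_subset_Icc_self
    refine h1.congr_fun (fun y hy => ?_) measurableSet_Ioo
    have hy : 0 < y := hy.1
    have : y ^ (n - 1) = y ^ N * y ^ (n - 1 - N) := by rw [← pow_add]; congr 1; omega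
    simp only [smul_eq_mul, this, div_pow]
    field_simp
  refine ne_top_of_le_ne_top hint.lintegral_lt_top.ne ?_
  refine (lintegral_mono_set hr).trans (lintegral_mono fun x => ?_)
  gcongr
  · exact radialFunction_nonneg A x
  · rcases eq_or_ne x 0 with rfl | hx
    · simp [radialFunction_zero]
    · exact Real.sSup_le (hbound x hx) (by positivity)

/-- To compare volumes it suffices to compare the integrals of a power of the radial function. -/
theorem IsStarBody.volume_le (hA : IsStarBody A) {B : Set (E n)} (hB : MeasurableSet B) {N : ℕ}
    (hN : N < n) (h : ∫⁻ x in A, ENNReal.ofReal (radialFunction A x ^ N) ≤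
      ∫⁻ x in B, ENNReal.ofReal (radialFunction A x ^ N)) : volume A ≤ volume B := by
  have := nontrivial_E (pos_of_gt hN)
  have hAm := hA.isCompact.measurableSet
  -- The weight can fall below 1 at the origin, where `radialFunction` has a default value, so this
  -- null set is removed from `A`.
  have hdiff : volume (A \ {0}) = volume A := measure_sdiff_null (measure_singleton 0)
  rw [← hdiff]
  have hle : ∫⁻ x in A \ {0}, ENNReal.ofReal (radialFunction A x ^ N) ≤
      ∫⁻ x in A, ENNReal.ofReal (radialFunction A x ^ N) := lintegral_mono_set sdiff_subset
  refine measure_le_of_setLIntegral_le (hAm.diff (measurableSet_singleton 0)) hB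
    (W := fun x => ENNReal.ofReal (radialFunction A x ^ N)) (fun x hx => ?_) (fun x hx => ?_)
    (ne_top_of_le_ne_top (hA.lintegral_radialFunction_pow_ne_top hN) hle) (hle.trans h)
  · exact ENNReal.one_le_ofReal.2 (one_le_pow₀ (hA.one_le_radialFunction hx.2 hx.1))
  · refine ENNReal.ofReal_le_one.2 (pow_le_one₀ (radialFunction_nonneg A x) ?_)
    by_cases hxA : x ∈ A
    · obtain rfl : x = 0 := by_contra fun h0 => hx ⟨hxA, h0⟩
      rw [radialFunction_zero]
      exact zero_le_one
    · exact hA.radialFunction_le_one hxA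

end Radial

/-! ### Reduction to planar integrals -/

theorem smul_splitCoords {m ℓ : ℕ} (t : ℝ) (y : E m) (z : E ℓ) :
    t • splitCoords m ℓ (WithLp.toLp 2 (y, z)) = splitCoords m ℓ (WithLp.toLp 2 (t • y, t • z)) :=
  (map_smul (splitCoords m ℓ) t _).symm

theorem splitCoords_add {m ℓ : ℕ} (y y' : E m) (z z' : E ℓ) :
    splitCoords m ℓ (WithLp.toLp 2 (y, z)) + splitCoords m ℓ (WithLp.toLp 2 (y', z')) =
      splitCoords m ℓ (WithLp.toLp 2 (y + y', z + z')) :=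
  (map_add (splitCoords m ℓ) _ _).symm

theorem radialFunction_splitCoords_eq {m ℓ : ℕ} {A : Set (E (m + ℓ))} (hsym : IsBlockSymmetric ℓ A)
    {y y' : E m} {z z' : E ℓ} (hy : ‖y‖ = ‖y'‖) (hz : ‖z‖ = ‖z'‖) :
    radialFunction A (splitCoords m ℓ (WithLp.toLp 2 (y, z))) =
      radialFunction A (splitCoords m ℓ (WithLp.toLp 2 (y', z'))) := by
  unfold radialFunction
  congr 1
  ext t
  refine and_congr_right fun _ => ?_
  rw [smul_splitCoords, smul_splitCoords]
  exact mem_splitCoords_iff_of_norm_eq hsym (by simp [norm_smul, hy]) (by simp [norm_smul, hz])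

/-- The indicator function of a set, in the coordinates `(y, z)`. -/
noncomputable def splitIndicator {m ℓ : ℕ} (K : Set (E (m + ℓ))) : E m × E ℓ → ℝ≥0∞ :=
  indicator {x | splitCoords m ℓ (WithLp.toLp 2 x) ∈ K} 1

theorem measurable_splitCoords_toLp (m ℓ : ℕ) :
    Measurable fun x : E m × E ℓ => splitCoords m ℓ (WithLp.toLp 2 x) :=
  (splitCoords m ℓ).continuous.measurable.comp (WithLp.volume_preserving_toLp _ _).measurable

theorem measurable_splitIndicator {m ℓ : ℕ} {K : Set (E (m + ℓ))} (hK : MeasurableSet K) :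
    Measurable (splitIndicator K) :=
  measurable_one.indicator (measurable_splitCoords_toLp m ℓ hK)

theorem setLIntegral_splitCoords {m ℓ : ℕ} {K : Set (E (m + ℓ))} (hK : MeasurableSet K)
    {W : E (m + ℓ) → ℝ≥0∞} (hW : Measurable W) :
    ∫⁻ x in K, W x =
      ∫⁻ x : E m × E ℓ, splitIndicator K x * W (splitCoords m ℓ (WithLp.toLp 2 x)) := by
  have hmp : MeasurePreserving (fun x : E m × E ℓ => splitCoords m ℓ (WithLp.toLp 2 x)) :=
    (splitCoords m ℓ).measurePreserving.comp (WithLp.volume_preserving_toLp _ _)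
  rw [← lintegral_indicator hK, ← hmp.lintegral_comp (hW.indicator hK)]
  refine lintegral_congr fun x => ?_
  by_cases h : splitCoords m ℓ (WithLp.toLp 2 x) ∈ K
  · simp [splitIndicator, h]
  · simp [splitIndicator, h]

/-- Polar coordinates in both factors, after rotation averaging. Homogeneity of degree `-N` splits
the weight at radii `(q, p)` into a function of `q/p` times `p^(-N)`; the sphere constants are the
same for `A` and `B`. -/
theorem volume_le_of_profile_le {m ℓ : ℕ} (hm : 0 < m) (hℓ : 0 < ℓ) {A B : Set (E (m + ℓ))}
    (hA : IsStarBody A) (hsym : IsBlockSymmetric ℓ A) (hB : MeasurableSet B) {N : ℕ}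
    (hN : N < m + ℓ) (avg : RotationAverage (E m) (E ℓ)) {e : E m} {e' : E ℓ} (he : ‖e‖ = 1)
    (he' : ‖e'‖ = 1)
    (h : ∫⁻ p in Ioi (0 : ℝ), ∫⁻ q in Ioi (0 : ℝ), ENNReal.ofReal (p ^ (m - 1)) *
        (ENNReal.ofReal (q ^ (ℓ - 1)) * (ENNReal.ofReal (radialFunction A
          (splitCoords m ℓ (WithLp.toLp 2 (e, (q / p) • e'))) ^ N) * ENNReal.ofReal ((p ^ N)⁻¹) *
            avg.profile (splitIndicator A) (q, p))) ≤
      ∫⁻ p in Ioi (0 : ℝ), ∫⁻ q in Ioi (0 : ℝ), ENNReal.ofReal (p ^ (m - 1)) *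
        (ENNReal.ofReal (q ^ (ℓ - 1)) * (ENNReal.ofReal (radialFunction A
          (splitCoords m ℓ (WithLp.toLp 2 (e, (q / p) • e'))) ^ N) * ENNReal.ofReal ((p ^ N)⁻¹) *
            avg.profile (splitIndicator B) (q, p)))) :
    volume A ≤ volume B := by
  have := nontrivial_E hm
  have := nontrivial_E hℓ
  have hρ := hA.measurable_radialFunction
  set w : ℝ × ℝ → ℝ≥0∞ := fun x => ENNReal.ofReal (radialFunction A
    (splitCoords m ℓ (WithLp.toLp 2 (x.2 • e, x.1 • e'))) ^ N) with hw
  have hwm : Measurable w := by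
    have h1 : Measurable fun x : ℝ × ℝ => splitCoords m ℓ (WithLp.toLp 2 (x.2 • e, x.1 • e')) :=
      (measurable_splitCoords_toLp m ℓ).comp
        (by fun_prop : Measurable fun x : ℝ × ℝ => (x.2 • e, x.1 • e'))
    exact ((hρ.comp h1).pow_const N).ennreal_ofReal
  have hw_eq : ∀ p ∈ Ioi (0 : ℝ), ∀ q ∈ Ioi (0 : ℝ), w (q, p) = ENNReal.ofReal (radialFunction A
      (splitCoords m ℓ (WithLp.toLp 2 (e, (q / p) • e'))) ^ N) * ENNReal.ofReal ((p ^ N)⁻¹) := by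
    intro p hp q hq
    have hp : 0 < p := hp
    have h1 : splitCoords m ℓ (WithLp.toLp 2 (p • e, q • e')) =
        p • splitCoords m ℓ (WithLp.toLp 2 (e, (q / p) • e')) := by
      rw [smul_splitCoords, smul_smul, mul_div_cancel₀ _ hp.ne']
    simp only [hw]
    rw [h1, radialFunction_smul A hp, mul_comm, mul_pow, inv_pow,
      ENNReal.ofReal_mul (pow_nonneg (radialFunction_nonneg _ _) _)]
  have key : ∀ K : Set (E (m + ℓ)), MeasurableSet K →
      ∫⁻ x in K, ENNReal.ofReal (radialFunction A x ^ N) =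
      ((volume : Measure (E m)).toSphere univ * (volume : Measure (E ℓ)).toSphere univ) *
      ∫⁻ p in Ioi (0 : ℝ), ∫⁻ q in Ioi (0 : ℝ), ENNReal.ofReal (p ^ (m - 1)) *
        (ENNReal.ofReal (q ^ (ℓ - 1)) * (ENNReal.ofReal (radialFunction A
          (splitCoords m ℓ (WithLp.toLp 2 (e, (q / p) • e'))) ^ N) * ENNReal.ofReal ((p ^ N)⁻¹) *
            avg.profile (splitIndicator K) (q, p))) := by
    intro K hK
    have hprof := avg.measurable_profile _ (measurable_splitIndicator hK)
    have h1 : ∀ x : E m × E ℓ, ENNReal.ofReal (radialFunction A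
        (splitCoords m ℓ (WithLp.toLp 2 x)) ^ N) = w (‖x.2‖, ‖x.1‖) := fun x => by
      simp only [hw]
      rw [radialFunction_splitCoords_eq hsym (y := ‖x.1‖ • e) (y' := x.1) (z := ‖x.2‖ • e')
        (z' := x.2) (by simp [norm_smul, he]) (by simp [norm_smul, he'])]
    rw [setLIntegral_splitCoords hK (hρ.pow_const N).ennreal_ofReal]
    rw [lintegral_congr fun x => congrArg (splitIndicator K x * ·) (h1 x)]
    rw [avg.lintegral_mul_weight (measurable_splitIndicator hK) hwm,
      lintegral_prod_fun_norm (F := fun x : ℝ × ℝ =>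
        avg.profile (splitIndicator K) (x.2, x.1) * w (x.2, x.1)) (by fun_prop)]
    simp only [finrank_euclideanSpace_fin]
    congr 1
    refine setLIntegral_congr_fun measurableSet_Ioi fun p hp => ?_
    have hm : Measurable fun q : ℝ => ENNReal.ofReal (q ^ (ℓ - 1)) *
        (avg.profile (splitIndicator K) (q, p) * w (q, p)) := by
      have h2 : Measurable fun q : ℝ => avg.profile (splitIndicator K) (q, p) :=
        hprof.comp measurable_prodMk_right
      have h3 : Measurable fun q : ℝ => w (q, p) := hwm.comp measurable_prodMk_right
      fun_prop
    rw [← lintegral_const_mul _ hm]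
    refine setLIntegral_congr_fun measurableSet_Ioi fun q hq => ?_
    beta_reduce
    rw [hw_eq p hp q hq, mul_comm (avg.profile _ _)]
  refine hA.volume_le hB hN ?_
  rw [key A hA.isCompact.measurableSet, key B hB]
  exact mul_le_mul' le_rfl h

/-- For each rotation the integral over `Y` is the volume of the section by the rotated range of
`ι`. As every rotated range stays in the class, the section inequality holds for each `ω` and can be
integrated. -/
theorem lintegral_profile_le {m ℓ i : ℕ} {A B : Set (E (m + ℓ))} (hA : MeasurableSet A)
    (hB : MeasurableSet B) (hAB : SectionsLE i ℓ A B) (avg : RotationAverage (E m) (E ℓ))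
    {Y : Type*} [NormedAddCommGroup Y] [InnerProductSpace ℝ Y] [FiniteDimensional ℝ Y]
    [MeasurableSpace Y] [BorelSpace Y] (ι : Y →ₗᵢ[ℝ] WithLp 2 (E m × E ℓ))
    (hι : ∀ γ₁ γ₂, LinearMap.range ((splitCoords m ℓ).toLinearIsometry.comp
      ((blockDiagonal γ₁ γ₂).toLinearIsometry.comp ι)).toLinearMap ∈
        equalAngleGrassmannian (m + ℓ) i ℓ) :
    ∫⁻ y, avg.profile (splitIndicator A) (‖(ι y).snd‖, ‖(ι y).fst‖) ≤
      ∫⁻ y, avg.profile (splitIndicator B) (‖(ι y).snd‖, ‖(ι y).fst‖) := by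
  have hm : Measurable fun y => (WithLp.ofLp (ι y)) :=
    (WithLp.volume_preserving_ofLp (E m) (E ℓ)).measurable.comp ι.continuous.measurable
  have hm₁ : Measurable fun y => (ι y).fst := measurable_fst.comp hm
  have hm₂ : Measurable fun y => (ι y).snd := measurable_snd.comp hm
  rw [← avg.lintegral_section volume hm₁ hm₂ (measurable_splitIndicator hA),
    ← avg.lintegral_section volume hm₁ hm₂ (measurable_splitIndicator hB)]
  refine lintegral_mono fun ω => ?_
  have key : ∀ K : Set (E (m + ℓ)), MeasurableSet K →
      ∫⁻ y, splitIndicator K (avg.γ₁ ω (ι y).fst, avg.γ₂ ω (ι y).snd) =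
      sectionVolume K (LinearMap.range ((splitCoords m ℓ).toLinearIsometry.comp
        ((blockDiagonal (avg.γ₁ ω) (avg.γ₂ ω)).toLinearIsometry.comp ι)).toLinearMap) := by
    intro K hK
    rw [sectionVolume_range _ hK]
    exact lintegral_indicator_one (((splitCoords m ℓ).toLinearIsometry.comp ((blockDiagonal (avg.γ₁ ω)
      (avg.γ₂ ω)).toLinearIsometry.comp ι)).continuous.measurable hK)
  rw [key A hA, key B hB]
  exact hAB _ (hι _ _)

/-! ### Sections of dimension at most `ℓ` -/

theorem volume_le_of_le {m ℓ i : ℕ} (hi : 1 ≤ i) (hiℓ : i ≤ ℓ) (hℓm : ℓ ≤ m)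
    {A B : Set (E (m + ℓ))} (hA : IsStarBody A) (hsym : IsBlockSymmetric ℓ A)
    (hB : MeasurableSet B) (hAB : SectionsLE i ℓ A B) : volume A ≤ volume B := by
  have hℓ : 0 < ℓ := by omega
  have hm : 0 < m := by omega
  have := nontrivial_E hm
  have := nontrivial_E hℓ
  have := nontrivial_E hi
  obtain ⟨avg⟩ := nonempty_rotationAverage (E m) (E ℓ)
  obtain ⟨e, he⟩ := exists_norm_eq (E m) zero_le_one
  obtain ⟨e', he'⟩ := exists_norm_eq (E ℓ) zero_le_one
  obtain ⟨S⟩ := nonempty_linearIsometry (hiℓ.trans hℓm)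
  obtain ⟨T⟩ := nonempty_linearIsometry hiℓ
  have hAm := hA.isCompact.measurableSet
  -- The exponent `n - i` is the one that leaves `r^(i-1)` on each ray, the radial density of an
  -- `i`-dimensional section.
  refine volume_le_of_profile_le hm hℓ hA hsym hB (N := m + ℓ - i) (by omega) avg he he' ?_
  have hpA := avg.measurable_profile _ (measurable_splitIndicator hAm)
  have hpB := avg.measurable_profile _ (measurable_splitIndicator hB)
  have hh : Measurable fun u : ℝ => ENNReal.ofReal (radialFunction A
      (splitCoords m ℓ (WithLp.toLp 2 (e, u • e'))) ^ (m + ℓ - i)) :=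
    ((hA.measurable_radialFunction.comp ((measurable_splitCoords_toLp m ℓ).comp
      (by fun_prop : Measurable fun u : ℝ => (e, u • e')))).pow_const _).ennreal_ofReal
  refine lintegral_cone_le hpA hpB hh (i := i - 1) (by omega) ?_
  intro c s hc hs hcs
  -- Rotations are absorbed into the isometries `S` and `T`, with the same `c` and `s`.
  have hcomp : ∀ γ₁ γ₂, (blockDiagonal γ₁ γ₂).toLinearIsometry.comp (diagonalEmbedding S T hcs) =
      diagonalEmbedding (γ₁.toLinearIsometry.comp S) (γ₂.toLinearIsometry.comp T) hcs :=
    fun γ₁ γ₂ => LinearIsometry.ext fun x => by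
      simp [blockDiagonal_apply, diagonalEmbedding_apply]
  have hsec := lintegral_profile_le hAm hB hAB avg (diagonalEmbedding S T hcs) fun γ₁ γ₂ => by
    rw [hcomp]
    exact range_mem_equalAngleGrassmannian_of_le hiℓ _ _ hcs
  have key : ∀ Φ : ℝ × ℝ → ℝ≥0∞, Measurable Φ →
      ∫⁻ y, Φ (‖(diagonalEmbedding S T hcs y).snd‖, ‖(diagonalEmbedding S T hcs y).fst‖) =
      (volume : Measure (E i)).toSphere univ *
        ∫⁻ r in Ioi (0 : ℝ), ENNReal.ofReal (r ^ (i - 1)) * Φ (c * r, s * r) := by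
    intro Φ hΦ
    simp only [diagonalEmbedding_apply, WithLp.toLp_fst, WithLp.toLp_snd, norm_smul,
      LinearIsometry.norm_map, Real.norm_eq_abs, abs_of_pos hc, abs_of_pos hs]
    rw [lintegral_fun_norm volume (f := fun r => Φ (c * r, s * r)) (by fun_prop),
      finrank_euclideanSpace_fin]
  rw [key _ hpA, key _ hpB] at hsec
  exact (ENNReal.mul_le_mul_iff_right toSphere_univ_ne_zero (measure_ne_top _ _)).1 hsec

/-! ### Convex bodies and sections of dimension `ℓ + 1` or `ℓ + 2` -/

/-- For `u ≤ v` the point `(e, u e')` is a convex combination of `(e, v e')` and its reflection `(e,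
-v e')`, so any dilate of the latter two inside `A` brings that of the former. -/
theorem antitoneOn_radialFunction {m ℓ : ℕ} {A : Set (E (m + ℓ))} (hA : IsStarBody A)
    (hsym : IsBlockSymmetric ℓ A) (hconv : Convex ℝ A) {e : E m} (he : e ≠ 0) (e' : E ℓ) :
    AntitoneOn (fun u : ℝ => radialFunction A (splitCoords m ℓ (WithLp.toLp 2 (e, u • e'))))
      (Ioi 0) := by
  intro u hu v hv huv
  have hu : 0 < u := hu
  have hv : 0 < v := hv
  have hne : splitCoords m ℓ (WithLp.toLp 2 (e, u • e')) ≠ 0 := by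
    intro h
    rw [map_eq_zero_iff _ (splitCoords m ℓ).injective] at h
    exact he (congrArg WithLp.fst h)
  refine csSup_le_csSup (hA.bddAbove hne) ⟨0, hA.zero_mem_radialSet _⟩ fun t ht => ⟨ht.1, ?_⟩
  have h1 : splitCoords m ℓ (WithLp.toLp 2 (t • e, (t * v) • e')) ∈ A := by
    have := ht.2
    rwa [smul_splitCoords, smul_smul] at this
  have h2 : splitCoords m ℓ (WithLp.toLp 2 (t • e, -(t * v) • e')) ∈ A :=
    (mem_splitCoords_iff_of_norm_eq hsym rfl (by simp)).1 h1
  -- The weights sum to 1 and differ by `u / v`, which turns `v` into `u` in the last component.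
  have hcomb := hconv h1 h2 (a := (1 + u / v) / 2) (b := (1 - u / v) / 2) (by positivity)
    (by have : u / v ≤ 1 := (div_le_one hv).2 huv
        linarith) (by ring)
  convert! hcomb using 1
  rw [smul_splitCoords, smul_splitCoords, smul_splitCoords, splitCoords_add, smul_smul, smul_smul,
    smul_smul, ← add_smul, smul_smul, smul_smul, ← add_smul]
  congr 4
  · ring
  · field_simp
    ring

theorem volume_le_of_convex {m ℓ k : ℕ} (hk : k = 1 ∨ k = 2) (hℓ : 0 < ℓ) (hkm : ℓ + k ≤ m)
    {A B : Set (E (m + ℓ))} (hA : IsStarBody A) (hsym : IsBlockSymmetric ℓ A) (hconv : Convex ℝ A)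
    (hB : MeasurableSet B) (hAB : SectionsLE (ℓ + k) ℓ A B) : volume A ≤ volume B := by
  have hk0 : 0 < k := by omega
  have hm : 0 < m := by omega
  have := nontrivial_E hm
  have := nontrivial_E hℓ
  have := nontrivial_E hk0
  obtain ⟨avg⟩ := nonempty_rotationAverage (E m) (E ℓ)
  obtain ⟨e, he⟩ := exists_norm_eq (E m) zero_le_one
  obtain ⟨e', he'⟩ := exists_norm_eq (E ℓ) zero_le_one
  obtain ⟨S₀⟩ := nonempty_linearIsometry hkm
  set S := S₀.comp (splitCoords ℓ k).toLinearIsometry with hS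
  have hAm := hA.isCompact.measurableSet
  -- Again `N = n - i`; dividing `p^(m-1)` by `p^N` leaves the wedge density `p^(k-1)`.
  refine volume_le_of_profile_le hm hℓ hA hsym hB (N := m - k) (by omega) avg he he' ?_
  have hpA := avg.measurable_profile _ (measurable_splitIndicator hAm)
  have hpB := avg.measurable_profile _ (measurable_splitIndicator hB)
  have hg : Measurable fun u : ℝ => radialFunction A
      (splitCoords m ℓ (WithLp.toLp 2 (e, u • e'))) ^ (m - k) :=
    (hA.measurable_radialFunction.comp ((measurable_splitCoords_toLp m ℓ).comp
      (by fun_prop : Measurable fun u : ℝ => (e, u • e')))).pow_const _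
  have hanti : AntitoneOn (fun u : ℝ => radialFunction A
      (splitCoords m ℓ (WithLp.toLp 2 (e, u • e'))) ^ (m - k)) (Ioi 0) := fun u hu v hv huv =>
    pow_le_pow_left₀ (radialFunction_nonneg _ _) (antitoneOn_radialFunction hA hsym hconv
      (norm_ne_zero_iff.1 (by rw [he]; exact one_ne_zero)) e' hu hv huv) _
  refine lintegral_antitone_le hpA hpB hg hanti (j := k - 1) (by omega) fun τ hτ => ?_
  refine wedge_section_le hpA hpB (by omega) (fun τ hτ => ?_) hτ
  refine slope_section_le hpA hpB (fun c s hc hs hcs => ?_) hτ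
  -- The rotation `γ₁` is absorbed into `S`, but `γ₂` must be kept: `z` occurs in both components of
  -- the embedding and only the last one is rotated.
  have hsec := lintegral_profile_le hAm hB hAB avg (slopeEmbedding S hcs) fun γ₁ γ₂ =>
    range_mem_equalAngleGrassmannian_of_lt hk0 (γ₁.toLinearIsometry.comp S) γ₂ hcs _ fun x => rfl
  have key : ∀ Φ : ℝ × ℝ → ℝ≥0∞, Measurable Φ →
      ∫⁻ y, Φ (‖(slopeEmbedding S hcs y).snd‖, ‖(slopeEmbedding S hcs y).fst‖) =
      ((volume : Measure (E ℓ)).toSphere univ * (volume : Measure (E k)).toSphere univ) *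
        ∫⁻ r in Ioi (0 : ℝ), ENNReal.ofReal (r ^ (ℓ - 1)) * ∫⁻ t in Ioi (0 : ℝ),
          ENNReal.ofReal (t ^ (k - 1)) * Φ (c * r, √((s * r) ^ 2 + t ^ 2)) := by
    intro Φ hΦ
    simp only [slopeEmbedding_apply, WithLp.toLp_fst, WithLp.toLp_snd, norm_smul,
      LinearIsometry.norm_map, WithLp.prod_norm_eq_of_L2, Real.norm_eq_abs, abs_of_pos hc,
      abs_of_nonneg hs]
    rw [← (WithLp.volume_preserving_toLp (E ℓ) (E k)).lintegral_comp_emb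
      (MeasurableEquiv.toLp 2 (E ℓ × E k)).measurableEmbedding]
    simp only [WithLp.toLp_fst, WithLp.toLp_snd]
    rw [lintegral_prod_fun_norm (F := fun x : ℝ × ℝ => Φ (c * x.1, √((s * x.1) ^ 2 + x.2 ^ 2)))
      (by fun_prop)]
    simp only [finrank_euclideanSpace_fin]
  rw [key _ hpA, key _ hpB] at hsec
  exact (ENNReal.mul_le_mul_iff_right (mul_ne_zero toSphere_univ_ne_zero toSphere_univ_ne_zero)
    (ENNReal.mul_ne_top (measure_ne_top _ _) (measure_ne_top _ _))).1 hsec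

end BusemannPetty

theorem theorem1p1 (n ℓ i : ℕ) (hℓ : 1 ≤ ℓ) (hℓn : 2 * ℓ ≤ n) (hi : i + ℓ ≤ n)
    (A : Set (BusemannPetty.E n)) (hA : BusemannPetty.IsStarBody A)
    (hsym : BusemannPetty.IsBlockSymmetric ℓ A) :
    (1 ≤ i → i ≤ ℓ →
      ∀ B : Set (BusemannPetty.E n), BusemannPetty.IsStarBody B →
        BusemannPetty.IsOriginSymmetric B → BusemannPetty.SectionsLE i ℓ A B →
        MeasureTheory.volume A ≤ MeasureTheory.volume B) ∧
    ((i = ℓ + 1 ∨ i = ℓ + 2) → Convex ℝ A →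
      ∀ B : Set (BusemannPetty.E n), BusemannPetty.IsStarBody B →
        BusemannPetty.IsOriginSymmetric B → BusemannPetty.SectionsLE i ℓ A B →
        MeasureTheory.volume A ≤ MeasureTheory.volume B) := by
  obtain ⟨m, rfl⟩ : ∃ m, n = m + ℓ := ⟨n - ℓ, by omega⟩
  refine ⟨fun h1 hiℓ B hB _ hAB => ?_, fun hi' hconv B hB _ hAB => ?_⟩
  · exact BusemannPetty.volume_le_of_le h1 hiℓ (by omega) hA hsym hB.isCompact.measurableSet hAB
  · obtain ⟨k, hk, rfl⟩ : ∃ k, (k = 1 ∨ k = 2) ∧ i = ℓ + k := by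
      rcases hi' with rfl | rfl
      · exact ⟨1, .inl rfl, rfl⟩
      · exact ⟨2, .inr rfl, rfl⟩
    exact BusemannPetty.volume_le_of_convex hk hℓ (by omega) hA hsym hconv
      hB.isCompact.measurableSet hAB
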